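/- Let $n$ be a natural number and let $\mathcal H_1,\mathcal H_0,\mathcal H_{-1}$ be complex Hilbert spaces. **Notation.** For an $n$-tuple $T=(T_1,\dots,T_n)$ of bounded operators on a Hilbert space $\mathcal H$ write also $T:\mathcal H^n\to\mathcal H$, $T(h_1,\dots,h_n)=\sum_i T_ih_i$, for the row operator. $T$ is a *commuting row contraction* if the $T_i$ commute pairwise and the row operator is a contraction. Put $D_T=(I-T^*T)^{1/2}$ on $\mathcal H^n$, $D_{T^*}=(I-TT^*)^{1/2}$ on $\mathcal H$, $\mathcal D_T=\overline{\operatorname{ran}}\,D_T$, $\mathcal D_{T^*}=\overline{\operatorname{ran}}\,D_{T^*}$. The *characteristic function* of a commuting row contraction $T$ is the function on the open unit ball $\mathbb B^n\subset\mathbb C^n$ with values in $\mathcal B(\mathcal D_T,\mathcal D_{T^*})$, $$\theta_T(z)=\bigl(-T+D_{T^*}(I-ZT^*)^{-1}ZD_T\bigr)\big|_{\mathcal D_T},\qquad Z=(z_1I_{\mathcal H},\dots,z_nI_{\mathcal H}):\mathcal H^n\to\mathcal H .$$ For a Hilbert space $\mathcal E$, $H^2_n\otimes\mathcal E=H^2_n(\mathcal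 E)$ is the $\mathcal E$-valued Drury–Arveson space of power series $f(z)=\sum_{\alpha\in\mathbb Z_+^n}a_\alpha z^\alpha$ with $a_\alpha\in\mathcal E$ and $\|f\|^2=\sum_\alpha\|a_\alpha\|^2/\gamma_\alpha<\infty$, $\gamma_\alpha=|\alpha|!/\alpha!$. A *multiplier* is a holomorphic $\varphi:\mathbb B^n\to\mathcal B(\mathcal E,\mathcal E_*)$ for which $f\mapsto\varphi f$ is a (bounded) operator $H^2_n(\mathcal E)\to H^2_n(\mathcal E_*)$; this multiplication operator is again denoted $\varphi$. Bounded operators $M:H^2_n\otimes\mathcal E\to H^2_n\otimes\mathcal E_*$ and $M':H^2_n\otimes\mathcal E'\to H^2_n\otimes\mathcal E'_*$ *coincide* if there are unitaries $W:\mathcal E\to\mathcal E'$ and $W_*:\mathcal E_*\to\mathcal E'_*$ with $(I\otimes W_*)M=M'(I\otimes W)$. $T$ is a *Drury–Arveson shift* if, for some Hilbert space $\mathcal W$, it is unitarily equivalent to the tuple of multiplications by the coordinates $(M_{z_1},\dots,M_{z_n})$ on $H^2_n(\mathcal W)$, and a *spherical co-isometry* if $\sum_iT_iT_i^*=I$.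 **Theorem.** Let $T=(T_1,\dots,T_n)$ be a commuting row contraction on $\mathcal H_1\oplus\mathcal H_0\oplus\mathcal H_{-1}$ such that, with respect to this decomposition, $$T_i=\begin{bmatrix}S_i&*&*\\0&N_i&*\\0&0&C_i\end{bmatrix}\qquad(i=1,\dots,n).$$ Then $S$ on $\mathcal H_1$, $N$ on $\mathcal H_0$ and $C$ on $\mathcal H_{-1}$ are commuting row contractions; $\theta_T,\theta_S,\theta_N,\theta_C$ are multipliers; and there exist Hilbert spaces $\mathcal E_1,\mathcal E_2,\mathcal E$ and unitary operators $U_1:\mathcal D_{N^*}\oplus\mathcal E\to\mathcal D_C\oplus\mathcal E_1$ and $U_2:\mathcal D_{S^*}\oplus\mathcal E_2\to\mathcal D_N\oplus\mathcal E$ such that $\theta_T$ coincides with $$\begin{bmatrix}\theta_C&0\\0&I_{H^2_n\otimes\mathcal E_1}\end{bmatrix}(I_{H^2_n}\otimes U_1)\begin{bmatrix}\theta_N&0\\0&I_{H^2_n\otimes\mathcal E}\end{bmatrix}(I_{H^2_n}\otimes U_2)\begin{bmatrix}\theta_S&0\\0&I_{H^2_n\otimes\mathcal E_2}\end{bmatrix}.$$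 In addition, if $S$ is a Drury–Arveson shift and $C$ is a spherical co-isometry, then there exist a Hilbert space $\mathcal E$, a co-isometry $G_1\in\mathcal B(H^2_n\otimes(\mathcal D_{N^*}\oplus\mathcal E),H^2_n\otimes\mathcal D_{T^*})$ and a partial isometry $G_2\in\mathcal B(H^2_n\otimes\mathcal D_T,H^2_n\otimes(\mathcal D_N\oplus\mathcal E))$ such that $$\theta_T=G_1\begin{bmatrix}\theta_N&0\\0&I_{H^2_n\otimes\mathcal E}\end{bmatrix}G_2 .$$ -/

import Mathlib

universe u

namespace DruryArveson

open ContinuousLinearMap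

noncomputable section

/-! ### Row contractions and their defect operators -/

section RowContractions

variable {E F : Type*} [NormedAddCommGroup E] [InnerProductSpace ℂ E] [CompleteSpace E]
  [NormedAddCommGroup F] [InnerProductSpace ℂ F] [CompleteSpace F]

/-- The defect operator `D_A = (I - A* A)^{1/2}` of a contraction `A : E → F`. -/
def defectOp (A : E →L[ℂ] F) : E →L[ℂ] E := CFC.sqrt (1 - adjoint A ∘L A)

/-- The defect space `𝓓_A`, the closure of the range of `D_A`. -/
abbrev defectSpace (A : E →L[ℂ] F) : Submodule ℂ E :=
  (LinearMap.range (defectOp A : E →ₗ[ℂ] E)).topologicalClosure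

lemma one_sub_adjoint_comp_self_nonneg {A : E →L[ℂ] F} (hA : ‖A‖ ≤ 1) :
    0 ≤ 1 - adjoint A ∘L A := by
  rw [ContinuousLinearMap.nonneg_iff_isPositive, ContinuousLinearMap.isPositive_def]
  refine ⟨?_, fun x => ?_⟩
  · intro x y
    simp [inner_sub_left, inner_sub_right, adjoint_inner_left, adjoint_inner_right]
  · have h1 : ‖A x‖ ≤ ‖x‖ := by
      simpa using (A.le_opNorm x).trans (mul_le_mul_of_nonneg_right hA (norm_nonneg x))
    have h2 : RCLike.re (inner ℂ (A x) (A x)) = ‖A x‖ ^ 2 := inner_self_eq_norm_sq (𝕜 := ℂ) (A x)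
    have h3 : RCLike.re (inner ℂ x x) = ‖x‖ ^ 2 := inner_self_eq_norm_sq (𝕜 := ℂ) x
    have h4 : (1 - adjoint A ∘L A).reApplyInnerSelf x = ‖x‖ ^ 2 - ‖A x‖ ^ 2 := by
      rw [reApplyInnerSelf_apply, ← h2, ← h3]
      simp [inner_sub_left, adjoint_inner_left]
    rw [h4]
    nlinarith [norm_nonneg (A x)]

lemma defectOp_sq {A : E →L[ℂ] F} (hA : ‖A‖ ≤ 1) (x : E) :
    defectOp A (defectOp A x) = x - adjoint A (A x) := by
  have h := CFC.sqrt_mul_sqrt_self (1 - adjoint A ∘L A) (one_sub_adjoint_comp_self_nonneg hA)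
  simpa [defectOp] using congrArg (fun B : E →L[ℂ] E => B x) h

lemma adjoint_defectOp (A : E →L[ℂ] F) : adjoint (defectOp A) = defectOp A := by
  have h : IsSelfAdjoint (defectOp A) := IsSelfAdjoint.of_nonneg (CFC.sqrt_nonneg _)
  exact h

/-- A contraction `A` maps its defect space into the defect space of `A*`. -/
lemma map_mem_defectSpace {A : E →L[ℂ] F} (hA : ‖A‖ ≤ 1) {x : E} (hx : x ∈ defectSpace A) :
    A x ∈ defectSpace (adjoint A) := by
  have hA' : ‖adjoint A‖ ≤ 1 := by simpa using hA
  have key : ∀ y : E, A (defectOp A y) ∈ defectSpace (adjoint A) := by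
    intro y
    rw [defectSpace, ← Submodule.orthogonal_orthogonal_eq_closure]
    have ho : (LinearMap.range (defectOp (adjoint A) : F →ₗ[ℂ] F))ᗮ
        = LinearMap.ker (defectOp (adjoint A) : F →ₗ[ℂ] F) := by
      have := orthogonal_range (defectOp (adjoint A))
      rwa [adjoint_defectOp] at this
    rw [ho, Submodule.mem_orthogonal]
    intro k hk
    have hk0 : defectOp (adjoint A) k = 0 := hk
    have h1 : k - A (adjoint A k) = 0 := by
      have := defectOp_sq hA' k
      rw [hk0, map_zero, adjoint_adjoint] at this
      exact this.symm
    have h2 : defectOp A (defectOp A (adjoint A k)) = 0 := by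
      rw [defectOp_sq hA]
      have := congrArg (adjoint A) h1
      simpa using this
    have h3 : defectOp A (adjoint A k) = 0 := by
      have h4 : inner ℂ (defectOp A (adjoint A k)) (defectOp A (adjoint A k)) = 0 := by
        conv_lhs => rw [← adjoint_inner_left, adjoint_defectOp, h2]
        simp
      exact inner_self_eq_zero.mp h4
    rw [← adjoint_inner_left, ← adjoint_inner_left, adjoint_defectOp, h3, inner_zero_left]
  have hcl : IsClosed (A ⁻¹' (defectSpace (adjoint A) : Set F)) :=
    (Submodule.isClosed_topologicalClosure _).preimage A.continuous
  exact closure_minimal (by rintro _ ⟨y, rfl⟩; exact key y) hcl hx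

variable {n : ℕ} {H : Type*} [NormedAddCommGroup H] [InnerProductSpace ℂ H] [CompleteSpace H]

/-- The row operator `H^n → H`, `(h₁, …, hₙ) ↦ ∑ Tᵢ hᵢ`, of an `n`-tuple `T`. -/
def row (T : Fin n → H →L[ℂ] H) : PiLp 2 (fun _ : Fin n => H) →L[ℂ] H :=
  ∑ i, T i ∘L PiLp.proj 2 (fun _ : Fin n => H) i

/-- `T` is a commuting row contraction: the `Tᵢ` commute and the row operator is a contraction. -/
structure IsCommutingRowContraction (T : Fin n → H →L[ℂ] H) : Prop where
  commute : ∀ i j, T i ∘L T j = T j ∘L T i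
  contraction : ‖row T‖ ≤ 1

/-- `C` is a spherical co-isometry: `∑ Cᵢ Cᵢ* = I`. -/
def IsSphericalCoisometry (C : Fin n → H →L[ℂ] H) : Prop :=
  ∑ i, C i ∘L adjoint (C i) = ContinuousLinearMap.id ℂ H

/-- The operator `Z T* = ∑ zᵢ Tᵢ*`. -/
def zStar (T : Fin n → H →L[ℂ] H) (z : EuclideanSpace ℂ (Fin n)) : H →L[ℂ] H :=
  ∑ i, z i • adjoint (T i)

/-- The row operator `Z = (z₁ I, …, zₙ I) : H^n → H`. -/
def zRow (H : Type*) [NormedAddCommGroup H] [InnerProductSpace ℂ H] [CompleteSpace H]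
    (z : EuclideanSpace ℂ (Fin n)) : PiLp 2 (fun _ : Fin n => H) →L[ℂ] H :=
  row fun i => z i • ContinuousLinearMap.id ℂ H

/-- `-T + D_{T*} (I - Z T*)⁻¹ Z D_T : H^n → H`. For `‖z‖ < 1` and `T` a row contraction,
`I - Z T*` is invertible, so that `Ring.inverse` is its inverse. -/
def preCharFun (T : Fin n → H →L[ℂ] H) (z : EuclideanSpace ℂ (Fin n)) :
    PiLp 2 (fun _ : Fin n => H) →L[ℂ] H :=
  -row T + defectOp (adjoint (row T)) ∘L Ring.inverse (1 - zStar T z) ∘L zRow H z ∘L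
    defectOp (row T)

/-- The characteristic function
`θ_T(z) = (-T + D_{T*} (I - Z T*)⁻¹ Z D_T)|_{𝓓_T} : 𝓓_T → 𝓓_{T*}`. The orthogonal projection onto
`𝓓_{T*}` only restricts the codomain, see `coe_charFun_apply`. -/
def charFun (T : Fin n → H →L[ℂ] H) (z : EuclideanSpace ℂ (Fin n)) :
    defectSpace (row T) →L[ℂ] defectSpace (adjoint (row T)) :=
  (defectSpace (adjoint (row T))).orthogonalProjectionOnto ∘L preCharFun T z ∘L
    (defectSpace (row T)).subtypeL

lemma coe_charFun_apply {T : Fin n → H →L[ℂ] H} (hT : ‖row T‖ ≤ 1)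
    (z : EuclideanSpace ℂ (Fin n)) (x : defectSpace (row T)) :
    (charFun T z x : H) = preCharFun T z x := by
  have h : preCharFun T z x ∈ defectSpace (adjoint (row T)) := by
    refine Submodule.add_mem _ (Submodule.neg_mem _ (map_mem_defectSpace hT x.2)) ?_
    exact Submodule.le_topologicalClosure _ ⟨_, rfl⟩
  exact Submodule.starProjection_eq_self_iff.mpr h

end RowContractions

/-! ### Vector-valued Drury–Arveson spaces -/

section Spaces

/-- The multinomial coefficient `γ_α = |α|! / α!`. -/
def gam {n : ℕ} (α : Fin n → ℕ) : ℕ := Nat.multinomial Finset.univ α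

/-- The Drury–Arveson space `H²ₙ(E) = H²ₙ ⊗ E`, the space of power series `∑ a_α z^α` with `a_α ∈ E`
and `∑ ‖a_α‖² / γ_α < ∞`. A series is recorded by its normalised coefficients `b_α = a_α / √γ_α`,
so that its squared norm is `∑ ‖b_α‖²`. -/
abbrev Space (n : ℕ) (E : Type*) [NormedAddCommGroup E] [InnerProductSpace ℂ E] : Type _ :=
  lp (fun _ : Fin n → ℕ => E) 2

variable {n : ℕ} {E F K : Type*} [NormedAddCommGroup E] [InnerProductSpace ℂ E]
  [NormedAddCommGroup F] [InnerProductSpace ℂ F] [NormedAddCommGroup K] [InnerProductSpace ℂ K]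

/-- The Taylor coefficient `a_α` of `f` at `z^α`. -/
def coeff (f : Space n E) (α : Fin n → ℕ) : E := (Real.sqrt (gam α) : ℂ) • f α

/-- The value `f(z) = ∑ z^α a_α` of `f ∈ H²ₙ(E)` at `z` (absolutely convergent for `‖z‖ < 1`). -/
def eval (f : Space n E) (z : EuclideanSpace ℂ (Fin n)) : E :=
  ∑' α : Fin n → ℕ, (∏ i, z i ^ α i) • coeff f α

/-- `M` is the operator of multiplication by `φ`: `(M f)(z) = φ(z) f(z)` on the unit ball. -/
def IsMulOp (φ : EuclideanSpace ℂ (Fin n) → E →L[ℂ] F) (M : Space n E →L[ℂ] Space n F) : Prop :=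
  ∀ f : Space n E, ∀ z ∈ Metric.ball (0 : EuclideanSpace ℂ (Fin n)) 1,
    eval (M f) z = φ z (eval f z)

/-- `φ` is a multiplier: it is holomorphic on the unit ball and multiplication by `φ` is an
operator from `H²ₙ(E)` to `H²ₙ(F)`, which is then bounded. -/
def IsMultiplier (φ : EuclideanSpace ℂ (Fin n) → E →L[ℂ] F) : Prop :=
  DifferentiableOn ℂ φ (Metric.ball 0 1) ∧ ∃ M : Space n E →L[ℂ] Space n F, IsMulOp φ M

open Classical in
/-- The multiplication operator `M_φ : H²ₙ(E) → H²ₙ(F)` of a multiplier `φ`. -/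
def mulOp (φ : EuclideanSpace ℂ (Fin n) → E →L[ℂ] F) : Space n E →L[ℂ] Space n F :=
  if h : ∃ M : Space n E →L[ℂ] Space n F, IsMulOp φ M then h.choose else 0

lemma isMulOp_mulOp {φ : EuclideanSpace ℂ (Fin n) → E →L[ℂ] F} (h : IsMultiplier φ) :
    IsMulOp φ (mulOp φ) := by
  rw [mulOp, dif_pos h.2]
  exact h.2.choose_spec

/-- The operator `I ⊗ A : H²ₙ ⊗ E → H²ₙ ⊗ F`, which applies `A : E → F` to every coefficient. -/
def ampl (n : ℕ) (A : E →L[ℂ] F) : Space n E →L[ℂ] Space n F :=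
  lp.mapCLM 2 (fun _ : Fin n → ℕ => A) (norm_nonneg A) fun _ => le_rfl

/-- The inclusion `E → E ⊕ K`, `x ↦ (x, 0)`. -/
def inlL (E K : Type*) [NormedAddCommGroup E] [InnerProductSpace ℂ E]
    [NormedAddCommGroup K] [InnerProductSpace ℂ K] : E →L[ℂ] WithLp 2 (E × K) :=
  (WithLp.prodContinuousLinearEquiv 2 ℂ E K).symm ∘L ContinuousLinearMap.inl ℂ E K

/-- The inclusion `K → E ⊕ K`, `y ↦ (0, y)`. -/
def inrL (E K : Type*) [NormedAddCommGroup E] [InnerProductSpace ℂ E]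
    [NormedAddCommGroup K] [InnerProductSpace ℂ K] : K →L[ℂ] WithLp 2 (E × K) :=
  (WithLp.prodContinuousLinearEquiv 2 ℂ E K).symm ∘L ContinuousLinearMap.inr ℂ E K

/-- The block diagonal operator `diag(M, I_{H²ₙ ⊗ K}) : H²ₙ ⊗ (E ⊕ K) → H²ₙ ⊗ (F ⊕ K)`. -/
def diagId (M : Space n E →L[ℂ] Space n F) (K : Type*) [NormedAddCommGroup K]
    [InnerProductSpace ℂ K] :
    Space n (WithLp 2 (E × K)) →L[ℂ] Space n (WithLp 2 (F × K)) :=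
  ampl n (inlL F K) ∘L M ∘L ampl n (WithLp.fstL 2 ℂ E K) +
    ampl n (inrL F K) ∘L ampl n (WithLp.sndL 2 ℂ E K)

/-- `M` and `M'` coincide: `(I ⊗ W_*) M = M' (I ⊗ W)` for unitaries `W : E → E'`, `W_* : F → F'`
between the coefficient spaces. -/
def Coincides {E' F' : Type*} [NormedAddCommGroup E'] [InnerProductSpace ℂ E']
    [NormedAddCommGroup F'] [InnerProductSpace ℂ F']
    (M : Space n E →L[ℂ] Space n F) (M' : Space n E' →L[ℂ] Space n F') : Prop :=
  ∃ (W : E ≃ₗᵢ[ℂ] E') (Ws : F ≃ₗᵢ[ℂ] F'),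
    ampl n (Ws : F →L[ℂ] F') ∘L M = M' ∘L ampl n (W : E →L[ℂ] E')

end Spaces

section Operators

variable {n : ℕ}

/-- The multiplication operator `H²ₙ ⊗ 𝓓_T → H²ₙ ⊗ 𝓓_{T*}` of the characteristic function. -/
def charOp {H : Type*} [NormedAddCommGroup H] [InnerProductSpace ℂ H] [CompleteSpace H]
    (T : Fin n → H →L[ℂ] H) :
    Space n (defectSpace (row T)) →L[ℂ] Space n (defectSpace (adjoint (row T))) :=
  mulOp (charFun T)

/-- `S` is a Drury–Arveson shift: up to a unitary, `Sᵢ` is multiplication by the coordinate `zᵢ` on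
some `H²ₙ(W)`. -/
def IsShift {H : Type u} [NormedAddCommGroup H] [InnerProductSpace ℂ H] [CompleteSpace H]
    (S : Fin n → H →L[ℂ] H) : Prop :=
  ∃ (W : Type u) (_ : NormedAddCommGroup W) (_ : InnerProductSpace ℂ W) (_ : CompleteSpace W)
    (U : H ≃ₗᵢ[ℂ] Space n W),
    ∀ i, IsMulOp (fun z : EuclideanSpace ℂ (Fin n) => z i • ContinuousLinearMap.id ℂ W)
      ((U : H →L[ℂ] Space n W) ∘L S i ∘L (U.symm : Space n W →L[ℂ] H))

variable {E F : Type*} [NormedAddCommGroup E] [InnerProductSpace ℂ E] [CompleteSpace E]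
  [NormedAddCommGroup F] [InnerProductSpace ℂ F] [CompleteSpace F]

/-- `G` is a co-isometry: `G G* = I`. -/
def IsCoisometry (G : E →L[ℂ] F) : Prop := G ∘L adjoint G = ContinuousLinearMap.id ℂ F

/-- `G` is a partial isometry: it is isometric on the orthogonal complement of its kernel. -/
def IsPartialIsometry (G : E →L[ℂ] F) : Prop :=
  ∀ x ∈ (LinearMap.ker (G : E →ₗ[ℂ] F))ᗮ, ‖G x‖ = ‖x‖

/-- The Hilbert space direct sum `H₁ ⊕ H₀ ⊕ H₋`. -/
abbrev Sum3 (H₁ H₀ Hm : Type*) : Type _ := WithLp 2 (H₁ × WithLp 2 (H₀ × Hm))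

/-- `T` on `H₁ ⊕ H₀ ⊕ H₋` has a block matrix `[[S, *, *], [0, N, *], [0, 0, C]]`. -/
def IsUpperTriangular {H₁ H₀ Hm : Type*}
    [NormedAddCommGroup H₁] [InnerProductSpace ℂ H₁] [NormedAddCommGroup H₀]
    [InnerProductSpace ℂ H₀] [NormedAddCommGroup Hm] [InnerProductSpace ℂ Hm]
    (T : Sum3 H₁ H₀ Hm →L[ℂ] Sum3 H₁ H₀ Hm)
    (S : H₁ →L[ℂ] H₁) (N : H₀ →L[ℂ] H₀) (C : Hm →L[ℂ] Hm) : Prop :=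
  ∃ (X : H₀ →L[ℂ] H₁) (Y : Hm →L[ℂ] H₁) (Z : Hm →L[ℂ] H₀), ∀ (a : H₁) (b : H₀) (c : Hm),
    T (WithLp.toLp 2 (a, WithLp.toLp 2 (b, c))) =
      WithLp.toLp 2 (S a + X b + Y c, WithLp.toLp 2 (N b + Z c, C c))

end Operators

end

end DruryArveson

open ContinuousLinearMap DruryArveson

set_option linter.unusedSectionVars false

namespace DruryArveson

open ContinuousLinearMap

/-! ### Multinomial series and uniqueness of power series coefficients -/

section Multinomial

variable {n : ℕ}

/-! The theorem reduces to a factorization for one contraction with a triangular block matrix `t =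
[[s, x], [0, c]]`. Its corner has the form `x = D_{s*} L D_c` with a contraction `L : 𝓓_c → 𝓓_{s*}`
(`exists_corner_factorization`). Norm computations then identify `𝓓_t` with `𝓓_s ⊕ 𝓓_L` and `𝓓_{t*}`
with `𝓓_{c*} ⊕ 𝓓_{L*}`. In these coordinates `θ_t = diag(θ_c, I) U diag(θ_s, I)`, where `U` is the
Julia unitary of `L` (`IsBlock.exists_transfer_factorization`). This is checked on the dense set of
vectors `D_t k`, where `θ_t D_t = D_{t*} R (Z - t)` turns it into solving `(I - Z t*) v = (Z - t) k`
componentwise. The three unitaries depend only on the block matrix and not on `z`, so they act on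
coefficients.

For three blocks, group the last two as `Q = [[N, *], [0, C]]`, factor `θ_T` through `θ_S` and
`θ_Q`, then factor `θ_Q` through `θ_N` and `θ_C`. Reassociating direct sums merges the two
factorizations (`factorization_trans`).

Passing from functions to operators takes two facts. Characteristic functions are multipliers: the
Julia operator of the row is isometric, so `(I - θ(w) θ(z)*) / (1 - ⟨w, z⟩)` is a positive kernel,
and `k_z ⊗ η ↦ k_z ⊗ θ(z)* η` extends to a contraction whose adjoint is multiplication by `θ`
(`exists_isMulOp_of_inner_eq`). A multiplication operator is determined by its symbol
(`IsMulOp.unique`), since an element of the space is determined by its values.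

For the last claim, a Drury–Arveson shift has `θ_S = 0` (`IsShiftModel.charFun_eq_zero`), and a
spherical co-isometry has `𝓓_{C*} = 0`. The outer factors thus become `diag(0, I)`, which is a
partial isometry, and a co-isometry on the side where the target of the zero block is trivial. -/

lemma sum_gam_mul_prod_pow {R : Type*} [CommSemiring R] (x : Fin n → R) (k : ℕ) :
    ∑ α ∈ Finset.piAntidiag Finset.univ k, (gam α : R) * ∏ i, x i ^ α i = (∑ i, x i) ^ k :=
  (Finset.sum_pow_eq_sum_piAntidiag _ _ _).symm

/-- Grouping the multi-indices by total degree `k` turns each group into a piece of `(∑ rᵢ)ᵏ` by the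
multinomial theorem, so a geometric series bounds all finite sums. -/
lemma summable_gam_mul_prod_pow {r : Fin n → ℝ} (h0 : ∀ i, 0 ≤ r i) (h1 : ∑ i, r i < 1) :
    Summable fun α : Fin n → ℕ => (gam α : ℝ) * ∏ i, r i ^ α i := by
  have hs : 0 ≤ ∑ i, r i := Finset.sum_nonneg fun i _ => h0 i
  have hnn : ∀ α : Fin n → ℕ, 0 ≤ (gam α : ℝ) * ∏ i, r i ^ α i := fun α =>
    mul_nonneg (Nat.cast_nonneg _) (Finset.prod_nonneg fun i _ => pow_nonneg (h0 i) _)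
  refine summable_of_sum_le (c := (1 - ∑ i, r i)⁻¹) hnn fun s => ?_
  classical
  have hmaps : ∀ α ∈ s, (∑ i, α i) ∈ s.image fun α => ∑ i, α i :=
    fun α hα => Finset.mem_image_of_mem _ hα
  rw [← Finset.sum_fiberwise_of_maps_to hmaps]
  calc _ ≤ ∑ k ∈ s.image fun α => ∑ i, α i, (∑ i, r i) ^ k := by
        refine Finset.sum_le_sum fun k _ => ?_
        rw [← sum_gam_mul_prod_pow]
        refine Finset.sum_le_sum_of_subset_of_nonneg (fun α hα => ?_) fun α _ _ => hnn α
        simpa using (Finset.mem_filter.1 hα).2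
    _ ≤ ∑' k : ℕ, (∑ i, r i) ^ k :=
        (summable_geometric_of_lt_one hs h1).sum_le_tsum _ fun k _ => pow_nonneg hs k
    _ = _ := tsum_geometric_of_lt_one hs h1

/-- With `xᵢ = zᵢ w̄ᵢ` this is the expansion of the Drury–Arveson kernel `1 / (1 - ⟨z, w⟩)`. -/
lemma hasSum_gam_mul_prod_pow {x : Fin n → ℂ} (h1 : ∑ i, ‖x i‖ < 1) :
    HasSum (fun α : Fin n → ℕ => (gam α : ℂ) * ∏ i, x i ^ α i) (1 - ∑ i, x i)⁻¹ := by
  have hsum : Summable fun α : Fin n → ℕ => (gam α : ℂ) * ∏ i, x i ^ α i := by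
    refine Summable.of_norm ?_
    simpa [norm_prod] using summable_gam_mul_prod_pow (fun i => norm_nonneg (x i)) h1
  have h := hsum.hasSum.tsum_fiberwise fun α => ∑ i, α i
  have hk : ∀ k : ℕ, ∑' α : (fun α : Fin n → ℕ => ∑ i, α i) ⁻¹' {k},
      (gam α.1 : ℂ) * ∏ i, x i ^ α.1 i = (∑ i, x i) ^ k := by
    intro k
    rw [← sum_gam_mul_prod_pow, ← Finset.tsum_subtype]
    have : ((fun α : Fin n → ℕ => ∑ i, α i) ⁻¹' {k}) =
        {α | α ∈ Finset.piAntidiag (Finset.univ : Finset (Fin n)) k} := by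
      ext α; simp
    rw [this]
    rfl
  simp only [hk] at h
  have h2 := hasSum_geometric_of_norm_lt_one ((norm_sum_le _ _).trans_lt h1)
  rw [h2.unique h]
  exact hsum.hasSum

lemma sum_norm_mul_lt_one {w z : EuclideanSpace ℂ (Fin n)} (hw : ‖w‖ < 1) (hz : ‖z‖ < 1) :
    ∑ i, ‖z i * star (w i)‖ < 1 := by
  have h := Finset.sum_mul_sq_le_sq_mul_sq Finset.univ (fun i => ‖z i‖) fun i => ‖w i‖
  rw [← EuclideanSpace.norm_sq_eq, ← EuclideanSpace.norm_sq_eq] at h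
  simp only [norm_mul, norm_star]
  have : 0 ≤ ∑ i, ‖z i‖ * ‖w i‖ := by positivity
  have h2 : ‖z‖ * ‖w‖ < 1 := by nlinarith [norm_nonneg w, norm_nonneg z]
  rw [← mul_pow] at h
  exact (abs_le_of_sq_le_sq' h (by positivity)).2.trans_lt h2

/-- An absolutely summable power series that vanishes near the origin has zero coefficients. -/
lemma coeff_eq_zero_of_hasSum_zero {c : (Fin n → ℕ) → ℂ} {r : ℝ} (hr : 0 < r)
    (h : ∀ z : Fin n → ℂ, (∀ i, ‖z i‖ = r) → HasSum (fun α => (∏ i, z i ^ α i) * c α) 0)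
    (α : Fin n → ℕ) : c α = 0 := by
  open UnitAddTorus in
  -- On the torus of radius `r` the power series is an absolutely convergent Fourier series, and its
  -- coefficients are recovered from orthonormality of the characters in `L²`.
  have hnorm : Summable fun α : Fin n → ℕ => ‖((r : ℂ) ^ (∑ i, α i) * c α) •
      mFourier (d := Fin n) fun i => (α i : ℤ)‖ := by
    have := (h (fun _ => r) fun _ => by simp [abs_of_pos hr]).summable.norm
    simpa [norm_smul, mFourier_norm, Finset.prod_pow_eq_pow_sum] using this
  have hC : HasSum (fun α : Fin n → ℕ => ((r : ℂ) ^ (∑ i, α i) * c α) •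
      UnitAddTorus.mFourier (d := Fin n) fun i => (α i : ℤ)) 0 := by
    have hs := hnorm.of_norm
    convert! hs.hasSum
    ext t
    have h1 := (ContinuousMap.evalCLM ℂ t).hasSum hs.hasSum
    have h2 := h (fun i => r * fourier 1 (t i)) fun i => by
      rw [norm_mul, fourier_apply, Circle.norm_coe]
      simp [abs_of_pos hr]
    refine h2.unique ?_
    convert! h1 using 2 with α
    simp [UnitAddTorus.mFourier, mul_pow, Finset.prod_mul_distrib, Finset.prod_pow_eq_pow_sum]
    simp only [AddCircle.toCircle_nsmul, Circle.coe_pow]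
    ring
  let _ : MeasureTheory.MeasureSpace UnitAddCircle := instMeasureSpaceUnitAddCircle
  have _ : MeasureTheory.IsProbabilityMeasure
      (MeasureTheory.volume : MeasureTheory.Measure UnitAddCircle) :=
    inferInstanceAs (MeasureTheory.IsProbabilityMeasure AddCircle.haarAddCircle)
  have hL : HasSum (fun α : Fin n → ℕ => ((r : ℂ) ^ (∑ i, α i) * c α) •
      UnitAddTorus.mFourierLp (d := Fin n) 2 fun i => (α i : ℤ)) 0 := by
    simpa [Function.comp_def] using (ContinuousMap.toLp (E := ℂ) 2
      (MeasureTheory.volume : MeasureTheory.Measure (UnitAddTorus (Fin n))) ℂ).hasSum hC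
  have hI := (innerSL ℂ (UnitAddTorus.mFourierLp (d := Fin n) 2 fun i => (α i : ℤ))).hasSum hL
  have hO := orthonormal_iff_ite.1 (UnitAddTorus.orthonormal_mFourier (d := Fin n))
  have h3 := hI.unique (hasSum_single α fun β hβ => by
    simp only [map_smul]
    have : (fun i => (α i : ℤ)) ≠ fun i => (β i : ℤ) := fun hh => hβ (by
      ext i; exact_mod_cast (congrFun hh i).symm)
    simp [hO, this])
  rw [map_smul, map_zero, innerSL_apply_apply, hO, if_pos rfl] at h3
  simpa [hr.ne'] using h3.symm

end Multinomial

/-! ### Reproducing kernel, point evaluations and multiplication operators -/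

section Kernel

variable {n : ℕ} {E F G K : Type*} [NormedAddCommGroup E] [InnerProductSpace ℂ E]
  [NormedAddCommGroup F] [InnerProductSpace ℂ F] [NormedAddCommGroup G] [InnerProductSpace ℂ G]
  [NormedAddCommGroup K] [InnerProductSpace ℂ K]

/-- The reproducing kernel vector `k_w ⊗ η` of `H²ₙ ⊗ E`. -/
noncomputable def kern (w : Metric.ball (0 : EuclideanSpace ℂ (Fin n)) 1) (η : E) : Space n E :=
  ⟨fun α => ((Real.sqrt (gam α) : ℂ) * ∏ i, star (w.1 i) ^ α i) • η, by
    have h := (summable_gam_mul_prod_pow (fun i => norm_nonneg (w.1 i * star (w.1 i)))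
      (sum_norm_mul_lt_one (mem_ball_zero_iff.1 w.2) (mem_ball_zero_iff.1 w.2))).mul_right (‖η‖ ^ 2)
    refine memℓp_gen ?_
    refine h.congr fun α => ?_
    have : (0 : ℝ) ≤ gam α := Nat.cast_nonneg _
    simp [norm_smul, mul_pow, ← Finset.prod_pow, Finset.prod_mul_distrib, Real.sq_sqrt this,
      abs_of_nonneg, Real.sqrt_nonneg]
    simp [sq, Finset.prod_mul_distrib]⟩

lemma kern_apply (w : Metric.ball (0 : EuclideanSpace ℂ (Fin n)) 1) (η : E) (α : Fin n → ℕ) :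
    kern w η α = ((Real.sqrt (gam α) : ℂ) * ∏ i, star (w.1 i) ^ α i) • η := rfl

/-- Each term is a product `(√γ_α |z^α|) ‖f α‖`, bounded by the sum of the squares of its two
factors. The first squares sum to the kernel on the diagonal, the second to `‖f‖²`. -/
lemma hasSum_eval [CompleteSpace E] (f : Space n E) {z : EuclideanSpace ℂ (Fin n)}
    (hz : z ∈ Metric.ball (0 : EuclideanSpace ℂ (Fin n)) 1) :
    HasSum (fun α : Fin n → ℕ => (∏ i, z i ^ α i) • coeff f α) (eval f z) := by
  refine Summable.hasSum ?_
  have h1 := summable_gam_mul_prod_pow (fun i => norm_nonneg (z i * star (z i)))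
    (sum_norm_mul_lt_one (mem_ball_zero_iff.1 hz) (mem_ball_zero_iff.1 hz))
  have h2 : Summable fun α => ‖f α‖ ^ 2 := by
    simpa using (lp.memℓp f).summable (by norm_num)
  refine Summable.of_norm_bounded (h1.add h2) fun α => ?_
  have hg : (0 : ℝ) ≤ gam α := Nat.cast_nonneg _
  have e1 : (gam α : ℝ) * ∏ i, ‖z i * star (z i)‖ ^ α i =
      (Real.sqrt (gam α) * ∏ i, ‖z i‖ ^ α i) ^ 2 := by
    simp only [norm_mul, norm_star, mul_pow, Finset.prod_mul_distrib, Real.sq_sqrt hg]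
    ring
  have e2 : ‖(∏ i, z i ^ α i) • coeff f α‖ =
      (Real.sqrt (gam α) * ∏ i, ‖z i‖ ^ α i) * ‖f α‖ := by
    simp [coeff, norm_smul, norm_prod, abs_of_nonneg, Real.sqrt_nonneg]
    ring
  rw [e1, e2]
  nlinarith [sq_nonneg ((Real.sqrt (gam α) * ∏ i, ‖z i‖ ^ α i) - ‖f α‖),
    sq_nonneg ((Real.sqrt (gam α) * ∏ i, ‖z i‖ ^ α i) + ‖f α‖)]

lemma inner_kern_left [CompleteSpace E] (w : Metric.ball (0 : EuclideanSpace ℂ (Fin n)) 1) (η : E)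
    (f : Space n E) : inner ℂ (kern w η) f = inner ℂ η (eval f w) := by
  have h1 := lp.hasSum_inner (𝕜 := ℂ) (kern w η) f
  have h2 := (innerSL ℂ η).hasSum (hasSum_eval f w.2)
  refine h1.unique ?_
  convert! h2 using 2 with α
  simp [kern_apply, coeff, inner_smul_left]
  ring

lemma eval_add [CompleteSpace E] (f g : Space n E)
    {z : EuclideanSpace ℂ (Fin n)} (hz : z ∈ Metric.ball (0 : EuclideanSpace ℂ (Fin n)) 1) :
    eval (f + g) z = eval f z + eval g z := by
  refine (hasSum_eval _ hz).unique ?_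
  simpa [coeff, smul_add] using (hasSum_eval f hz).add (hasSum_eval g hz)

lemma eval_sub [CompleteSpace E] (f g : Space n E)
    {z : EuclideanSpace ℂ (Fin n)} (hz : z ∈ Metric.ball (0 : EuclideanSpace ℂ (Fin n)) 1) :
    eval (f - g) z = eval f z - eval g z := by
  refine (hasSum_eval _ hz).unique ?_
  simpa [coeff, smul_sub] using (hasSum_eval f hz).sub (hasSum_eval g hz)

lemma eval_smul [CompleteSpace E] (c : ℂ) (f : Space n E)
    {z : EuclideanSpace ℂ (Fin n)} (hz : z ∈ Metric.ball (0 : EuclideanSpace ℂ (Fin n)) 1) :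
    eval (c • f) z = c • eval f z := by
  refine (hasSum_eval _ hz).unique ?_
  simpa [coeff, smul_comm c] using (hasSum_eval f hz).const_smul c

lemma eval_ampl [CompleteSpace E] [CompleteSpace F] (A : E →L[ℂ] F) (f : Space n E)
    {z : EuclideanSpace ℂ (Fin n)} (hz : z ∈ Metric.ball (0 : EuclideanSpace ℂ (Fin n)) 1) :
    eval (ampl n A f) z = A (eval f z) := by
  refine (hasSum_eval _ hz).unique ?_
  have h := A.hasSum (hasSum_eval f hz)
  convert! h using 2 with α
  simp [coeff, ampl]

lemma eval_kern [CompleteSpace E] (w z : Metric.ball (0 : EuclideanSpace ℂ (Fin n)) 1) (η : E) :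
    eval (kern w η) z = (1 - ∑ i, z.1 i * star (w.1 i))⁻¹ • η := by
  refine (hasSum_eval _ z.2).unique ?_
  have h := (hasSum_gam_mul_prod_pow
    (sum_norm_mul_lt_one (mem_ball_zero_iff.1 w.2) (mem_ball_zero_iff.1 z.2))).smul_const η
  convert! h using 2 with α
  have hg : (Real.sqrt (gam α) : ℂ) * Real.sqrt (gam α) = gam α := by
    rw [← Complex.ofReal_mul, Real.mul_self_sqrt (Nat.cast_nonneg _)]
    simp
  simp only [coeff, kern_apply, smul_smul, mul_pow, Finset.prod_mul_distrib, ← hg]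
  congr 1
  ring

lemma eq_zero_of_eval_eq_zero [CompleteSpace E] {f : Space n E}
    (h : ∀ z ∈ Metric.ball (0 : EuclideanSpace ℂ (Fin n)) 1, eval f z = 0) : f = 0 := by
  ext α
  -- The radius is small enough that `n r² < 1`, so the torus lies in the ball, also when `n = 0`.
  have hr : (0 : ℝ) < 1 / (n + 1) := by positivity
  have key : ∀ η : E, inner ℂ η (coeff f α) = 0 := by
    intro η
    refine coeff_eq_zero_of_hasSum_zero (c := fun α => inner ℂ η (coeff f α)) hr
      (fun z hz => ?_) α
    have hz1 : WithLp.toLp 2 z ∈ Metric.ball (0 : EuclideanSpace ℂ (Fin n)) 1 := by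
      rw [mem_ball_zero_iff, ← sq_lt_one_iff₀ (norm_nonneg _), EuclideanSpace.norm_sq_eq]
      simp only [hz, Finset.sum_const, Finset.card_univ, Fintype.card_fin, nsmul_eq_mul]
      rw [div_pow, one_pow, mul_one_div, div_lt_one (by positivity)]
      have : (0 : ℝ) ≤ n := Nat.cast_nonneg _
      nlinarith
    have h2 := (innerSL ℂ η).hasSum (hasSum_eval f hz1)
    rw [h _ hz1, map_zero] at h2
    simpa [Function.comp_def, inner_smul_right] using h2
  have h0 : coeff f α = 0 := inner_self_eq_zero.1 (key _)
  have hg' : (Real.sqrt (gam α) : ℂ) ≠ 0 := by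
    simpa [Real.sqrt_eq_zero', gam] using (Nat.multinomial_pos _ _).ne'
  exact (smul_eq_zero.1 h0).resolve_left hg'

lemma ext_eval [CompleteSpace E] {f g : Space n E}
    (h : ∀ z ∈ Metric.ball (0 : EuclideanSpace ℂ (Fin n)) 1, eval f z = eval g z) : f = g :=
  sub_eq_zero.1 (eq_zero_of_eval_eq_zero fun z hz => by rw [eval_sub _ _ hz, h z hz, sub_self])

/-- The finite linear combinations `∑ cⱼ k_{wⱼ} ⊗ ηⱼ`. -/
noncomputable def kernSum (n : ℕ) (E : Type*) [NormedAddCommGroup E] [InnerProductSpace ℂ E] :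
    (Metric.ball (0 : EuclideanSpace ℂ (Fin n)) 1 × E →₀ ℂ) →ₗ[ℂ] Space n E :=
  Finsupp.linearCombination ℂ fun p => kern p.1 p.2

/-- A vector orthogonal to every `k_z ⊗ f(z)` satisfies `‖f(z)‖² = 0` for all `z`. -/
lemma denseRange_kernSum [CompleteSpace E] : DenseRange (kernSum n E) := by
  have h : (LinearMap.range (kernSum n E)).topologicalClosure = ⊤ := by
    rw [Submodule.topologicalClosure_eq_top_iff, Submodule.eq_bot_iff]
    intro f hf
    refine eq_zero_of_eval_eq_zero fun z hz => ?_
    have h2 := (Submodule.mem_orthogonal _ _).1 hf (kern ⟨z, hz⟩ (eval f z))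
      ⟨Finsupp.single (⟨z, hz⟩, eval f z) 1, by simp [kernSum]⟩
    rw [inner_kern_left] at h2
    exact inner_self_eq_zero.1 h2
  have := Submodule.dense_iff_topologicalClosure_eq_top.2 h
  rwa [LinearMap.coe_range] at this

lemma IsMulOp.unique [CompleteSpace F] {φ : EuclideanSpace ℂ (Fin n) → E →L[ℂ] F}
    {M M' : Space n E →L[ℂ] Space n F} (h : IsMulOp φ M) (h' : IsMulOp φ M') : M = M' := by
  ext1 f
  exact ext_eval fun z hz => by rw [h f z hz, h' f z hz]

lemma IsMulOp.congr {φ ψ : EuclideanSpace ℂ (Fin n) → E →L[ℂ] F}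
    {M : Space n E →L[ℂ] Space n F} (h : IsMulOp φ M)
    (hφ : ∀ z ∈ Metric.ball (0 : EuclideanSpace ℂ (Fin n)) 1, φ z = ψ z) : IsMulOp ψ M :=
  fun f z hz => by rw [h f z hz, hφ z hz]

lemma isMulOp_ampl [CompleteSpace E] [CompleteSpace F] (A : E →L[ℂ] F) :
    IsMulOp (fun _ => A) (ampl n A) :=
  fun f _ hz => eval_ampl A f hz

lemma IsMulOp.comp {φ : EuclideanSpace ℂ (Fin n) → F →L[ℂ] G}
    {ψ : EuclideanSpace ℂ (Fin n) → E →L[ℂ] F} {M : Space n F →L[ℂ] Space n G}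
    {M' : Space n E →L[ℂ] Space n F} (h : IsMulOp φ M) (h' : IsMulOp ψ M') :
    IsMulOp (fun z => φ z ∘L ψ z) (M ∘L M') := fun f z hz => by
  simp [h _ z hz, h' f z hz]

lemma IsMulOp.add [CompleteSpace F] {φ ψ : EuclideanSpace ℂ (Fin n) → E →L[ℂ] F}
    {M M' : Space n E →L[ℂ] Space n F} (h : IsMulOp φ M) (h' : IsMulOp ψ M') :
    IsMulOp (fun z => φ z + ψ z) (M + M') := fun f z hz => by
  simp [eval_add _ _ hz, h f z hz, h' f z hz]

/-- The operator `diag(A, I_K) : E ⊕ K → F ⊕ K`. -/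
noncomputable def diagOne (A : E →L[ℂ] F) (K : Type*) [NormedAddCommGroup K]
    [InnerProductSpace ℂ K] : WithLp 2 (E × K) →L[ℂ] WithLp 2 (F × K) :=
  inlL F K ∘L A ∘L WithLp.fstL 2 ℂ E K + inrL F K ∘L WithLp.sndL 2 ℂ E K

@[simp]
lemma diagOne_apply (A : E →L[ℂ] F) (x : WithLp 2 (E × K)) :
    diagOne A K x = WithLp.toLp 2 (A x.fst, x.snd) := by
  simp only [diagOne, inlL, inrL, add_apply, ContinuousLinearMap.comp_apply]
  refine WithLp.ofLp_injective 2 ?_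
  ext <;> simp

lemma IsMulOp.diagId [CompleteSpace E] [CompleteSpace F] [CompleteSpace K]
    {φ : EuclideanSpace ℂ (Fin n) → E →L[ℂ] F} {M : Space n E →L[ℂ] Space n F} (h : IsMulOp φ M) :
    IsMulOp (fun z => diagOne (φ z) K) (diagId M K) :=
  ((isMulOp_ampl _).comp (h.comp (isMulOp_ampl _))).add ((isMulOp_ampl _).comp (isMulOp_ampl _))

end Kernel

/-! ### Defect operators and the Julia operator -/

section Defect

variable {E F : Type*} [NormedAddCommGroup E] [InnerProductSpace ℂ E] [CompleteSpace E]
  [NormedAddCommGroup F] [InnerProductSpace ℂ F] [CompleteSpace F]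

lemma isPositive_defectOp (A : E →L[ℂ] F) : (defectOp A).IsPositive :=
  (ContinuousLinearMap.nonneg_iff_isPositive _).1 (CFC.sqrt_nonneg _)

lemma inner_defectOp_left (A : E →L[ℂ] F) (x y : E) :
    inner ℂ (defectOp A x) y = inner ℂ x (defectOp A y) := by
  rw [← adjoint_inner_right, adjoint_defectOp]

lemma inner_defectOp_defectOp {A : E →L[ℂ] F} (hA : ‖A‖ ≤ 1) (x y : E) :
    inner ℂ (defectOp A x) (defectOp A y) = inner ℂ x y - inner ℂ (A x) (A y) := by
  rw [inner_defectOp_left, defectOp_sq hA, inner_sub_right, adjoint_inner_right]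

lemma norm_defectOp_sq {A : E →L[ℂ] F} (hA : ‖A‖ ≤ 1) (x : E) :
    ‖defectOp A x‖ ^ 2 = ‖x‖ ^ 2 - ‖A x‖ ^ 2 := by
  simp only [← inner_self_eq_norm_sq (𝕜 := ℂ), inner_defectOp_defectOp hA, map_sub]

/-- The positive operator `D` is the square root of `D * D`, hence a function of it in the
functional calculus. -/
lemma commute_of_commute_mul_self {D M : E →L[ℂ] E} (hD : 0 ≤ D) (h : Commute (D * D) M) :
    Commute D M := by
  rw [← CFC.sqrt_unique rfl hD]
  exact Commute.cfcₙ_nnreal h _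

/-- The intertwining relation `A D_A = D_{A*} A`. -/
lemma map_defectOp {A : E →L[ℂ] F} (hA : ‖A‖ ≤ 1) (x : E) :
    A (defectOp A x) = defectOp (adjoint A) (A x) := by
  have hA' : ‖adjoint A‖ ≤ 1 := by simpa using hA
  let e := WithLp.prodContinuousLinearEquiv 2 ℂ E F
  -- On `E ⊕ F` take `M = [[0, A*], [A, 0]]` and `D = diag(D_A, D_{A*})`. Then `D² = 1 - M²`
  -- commutes with `M`, so `D` does too, and one corner of `D M = M D` is the claim.
  let M : WithLp 2 (E × F) →L[ℂ] WithLp 2 (E × F) :=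
    (e.symm : E × F →L[ℂ] WithLp 2 (E × F)) ∘L
      ((adjoint A ∘L WithLp.sndL 2 ℂ E F).prod (A ∘L WithLp.fstL 2 ℂ E F))
  let D : WithLp 2 (E × F) →L[ℂ] WithLp 2 (E × F) :=
    (e.symm : E × F →L[ℂ] WithLp 2 (E × F)) ∘L
      ((defectOp A ∘L WithLp.fstL 2 ℂ E F).prod (defectOp (adjoint A) ∘L WithLp.sndL 2 ℂ E F))
  have hM : ∀ v, M v = WithLp.toLp 2 (adjoint A v.snd, A v.fst) := fun v => rfl
  have hD : ∀ v, D v = WithLp.toLp 2 (defectOp A v.fst, defectOp (adjoint A) v.snd) := fun v => rfl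
  have hD0 : 0 ≤ D := by
    rw [ContinuousLinearMap.nonneg_iff_isPositive, ContinuousLinearMap.isPositive_def]
    refine ⟨fun v w => ?_, fun v => ?_⟩
    · simp [hD, inner_defectOp_left]
    · have h1 := (isPositive_defectOp A).re_inner_nonneg_left v.fst
      have h2 := (isPositive_defectOp (adjoint A)).re_inner_nonneg_left v.snd
      simpa [hD, reApplyInnerSelf_apply] using add_nonneg h1 h2
  have hDD : D * D = 1 - M * M := by
    ext1 v
    refine WithLp.ofLp_injective 2 ?_
    ext <;> simp [hD, hM, defectOp_sq hA, defectOp_sq hA']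
  have hc : Commute D M := commute_of_commute_mul_self hD0
    (hDD ▸ (Commute.one_left M).sub_left ((Commute.refl M).mul_left (Commute.refl M)))
  have := congrArg (fun B : WithLp 2 (E × F) →L[ℂ] WithLp 2 (E × F) =>
    (B (WithLp.toLp 2 (x, 0))).snd) hc.eq
  simpa [hD, hM] using this.symm

/-- The Julia operator `[[A, D_{A*}], [D_A, -A*]]` is isometric. -/
lemma julia_inner {A : E →L[ℂ] F} (hA : ‖A‖ ≤ 1) (u u' : E) (η η' : F) :
    inner ℂ (A u + defectOp (adjoint A) η) (A u' + defectOp (adjoint A) η') +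
      inner ℂ (defectOp A u - adjoint A η) (defectOp A u' - adjoint A η') =
    inner ℂ u u' + inner ℂ η η' := by
  have hA' : ‖adjoint A‖ ≤ 1 := by simpa using hA
  -- The intertwining relation makes the cross terms of the two summands cancel.
  have h1 : inner ℂ (A u) (defectOp (adjoint A) η') = inner ℂ (defectOp A u) (adjoint A η') := by
    rw [adjoint_inner_right, map_defectOp hA, inner_defectOp_left]
  have h2 : inner ℂ (defectOp (adjoint A) η) (A u') = inner ℂ (adjoint A η) (defectOp A u') := by
    rw [adjoint_inner_left, map_defectOp hA, inner_defectOp_left]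
  simp only [inner_add_left, inner_add_right, inner_sub_left, inner_sub_right, h1, h2,
    inner_defectOp_defectOp hA, inner_defectOp_defectOp hA']
  ring

lemma julia_norm {A : E →L[ℂ] F} (hA : ‖A‖ ≤ 1) (u : E) (η : F) :
    ‖A u + defectOp (adjoint A) η‖ ^ 2 + ‖defectOp A u - adjoint A η‖ ^ 2 =
      ‖u‖ ^ 2 + ‖η‖ ^ 2 := by
  have h := congrArg Complex.re (julia_inner hA u u η η)
  rw [Complex.add_re, Complex.add_re] at h
  simpa only [← RCLike.re_eq_complex_re, inner_self_eq_norm_sq] using h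

lemma defectOp_mem (A : E →L[ℂ] F) (x : E) : defectOp A x ∈ defectSpace A :=
  Submodule.le_topologicalClosure _ ⟨x, rfl⟩

/-- The defect operator, with values in the defect space. -/
noncomputable def defectMap (A : E →L[ℂ] F) : E →L[ℂ] defectSpace A :=
  (defectOp A).codRestrict _ (defectOp_mem A)

@[simp]
lemma coe_defectMap (A : E →L[ℂ] F) (x : E) : (defectMap A x : E) = defectOp A x := rfl

lemma norm_defectMap_sq {A : E →L[ℂ] F} (hA : ‖A‖ ≤ 1) (x : E) :
    ‖defectMap A x‖ ^ 2 = ‖x‖ ^ 2 - ‖A x‖ ^ 2 :=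
  norm_defectOp_sq hA x

/-- The restriction of the defect operator to the defect space, the adjoint of `defectMap`. -/
noncomputable def defectIncl (A : E →L[ℂ] F) : defectSpace A →L[ℂ] E :=
  defectOp A ∘L (defectSpace A).subtypeL

lemma defectIncl_apply (A : E →L[ℂ] F) (y : defectSpace A) : defectIncl A y = defectOp A (y : E) :=
  rfl

lemma inner_defectMap_left (A : E →L[ℂ] F) (x : E) (y : defectSpace A) :
    inner ℂ (defectMap A x) y = inner ℂ x (defectIncl A y) :=
  inner_defectOp_left A x y

lemma inner_defectMap_right (A : E →L[ℂ] F) (x : E) (y : defectSpace A) :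
    inner ℂ y (defectMap A x) = inner ℂ (defectIncl A y) x :=
  (inner_defectOp_left A y x).symm

/-- The restriction of `A*` to an operator `𝓓_{A*} → 𝓓_A`. -/
lemma exists_adjoint_restrict {A : E →L[ℂ] F} (hA : ‖A‖ ≤ 1) :
    ∃ ρ : defectSpace (adjoint A) →L[ℂ] defectSpace A, ∀ y, (ρ y : E) = adjoint A (y : F) := by
  have hA' : ‖adjoint A‖ ≤ 1 := by simpa using hA
  have hm : ∀ y : defectSpace (adjoint A), adjoint A (y : F) ∈ defectSpace A := fun y => by
    have := map_mem_defectSpace hA' y.2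
    rwa [adjoint_adjoint] at this
  exact ⟨(adjoint A ∘L (defectSpace (adjoint A)).subtypeL).codRestrict _ hm, fun y => rfl⟩

/-- The restriction of `A` to an operator `𝓓_A → 𝓓_{A*}`. -/
lemma exists_restrict {A : E →L[ℂ] F} (hA : ‖A‖ ≤ 1) :
    ∃ κ : defectSpace A →L[ℂ] defectSpace (adjoint A), ∀ y, (κ y : F) = A (y : E) :=
  ⟨(A ∘L (defectSpace A).subtypeL).codRestrict _ fun y => map_mem_defectSpace hA y.2,
    fun _ => rfl⟩

lemma denseRange_defectMap (A : E →L[ℂ] F) : DenseRange (defectMap A) := by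
  intro y
  rw [closure_subtype]
  refine closure_mono ?_ y.2
  rintro _ ⟨x, rfl⟩
  exact ⟨defectMap A x, ⟨x, rfl⟩, rfl⟩

end Defect

/-! ### Positive kernels give contractive multipliers -/

section Contraction

variable {ι E F G : Type*} [NormedAddCommGroup E] [InnerProductSpace ℂ E]
  [NormedAddCommGroup F] [InnerProductSpace ℂ F] [CompleteSpace F]
  [NormedAddCommGroup G] [InnerProductSpace ℂ G]

/-- The Gram matrix of `a` exceeds that of `b` by the positive Gram matrix of `c`. So `∑ vᵢ aᵢ ↦ ∑
vᵢ bᵢ` is well defined and contractive on a dense subspace. -/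
lemma exists_clm_of_inner_eq_add {a : ι → E} {b : ι → F} {c : ι → G}
    (ha : DenseRange (Finsupp.linearCombination ℂ a))
    (h : ∀ i j, inner ℂ (a i) (a j) = inner ℂ (b i) (b j) + inner ℂ (c i) (c j)) :
    ∃ L : E →L[ℂ] F, ∀ i, L (a i) = b i := by
  have key : ∀ v : ι →₀ ℂ, inner ℂ (Finsupp.linearCombination ℂ a v) (Finsupp.linearCombination ℂ a v) =
      inner ℂ (Finsupp.linearCombination ℂ b v) (Finsupp.linearCombination ℂ b v) +
      inner ℂ (Finsupp.linearCombination ℂ c v) (Finsupp.linearCombination ℂ c v) := by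
    intro v
    simp only [Finsupp.linearCombination_apply, Finsupp.sum, sum_inner, inner_sum, inner_smul_left,
      inner_smul_right, h, mul_add, Finset.sum_add_distrib]
  have hle : ∀ v : ι →₀ ℂ, ‖Finsupp.linearCombination ℂ b v‖ ≤
      1 * ‖Finsupp.linearCombination ℂ a v‖ := by
    intro v
    have h1 := congrArg Complex.re (key v)
    rw [Complex.add_re] at h1
    simp only [← RCLike.re_eq_complex_re, inner_self_eq_norm_sq] at h1
    rw [one_mul, ← sq_le_sq₀ (norm_nonneg _) (norm_nonneg _)]
    nlinarith [sq_nonneg ‖Finsupp.linearCombination ℂ c v‖]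
  refine ⟨(Finsupp.linearCombination ℂ b).extendOfNorm (Finsupp.linearCombination ℂ a), fun i => ?_⟩
  simpa using LinearMap.extendOfNorm_eq ha ⟨1, hle⟩ (Finsupp.single i 1)

end Contraction

section Multiplier

variable {n : ℕ} {E F G : Type*} [NormedAddCommGroup E] [InnerProductSpace ℂ E] [CompleteSpace E]
  [NormedAddCommGroup F] [InnerProductSpace ℂ F] [CompleteSpace F]
  [NormedAddCommGroup G] [InnerProductSpace ℂ G]

/-- A function `φ` for which `(I - φ(z) φ(w)*) / (1 - ⟨z, w⟩)` factors as a positive kernel is a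
contractive multiplier. -/
lemma exists_isMulOp_of_inner_eq {φ : EuclideanSpace ℂ (Fin n) → E →L[ℂ] F}
    {g : EuclideanSpace ℂ (Fin n) → F → G}
    (h : ∀ w ∈ Metric.ball (0 : EuclideanSpace ℂ (Fin n)) 1,
      ∀ z ∈ Metric.ball (0 : EuclideanSpace ℂ (Fin n)) 1, ∀ η ξ : F,
        inner ℂ η ξ = inner ℂ (adjoint (φ w) η) (adjoint (φ z) ξ) +
          (1 - ∑ i, w i * star (z i)) * inner ℂ (g w η) (g z ξ)) :
    ∃ M : Space n E →L[ℂ] Space n F, IsMulOp φ M := by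
  -- This is the hypothesis divided by `1 - ⟨w, z⟩`, which is the reciprocal of the scalar kernel.
  have key : ∀ p q : Metric.ball (0 : EuclideanSpace ℂ (Fin n)) 1 × F,
      inner ℂ (kern p.1 p.2) (kern q.1 q.2) =
        inner ℂ (kern p.1 (adjoint (φ p.1) p.2)) (kern q.1 (adjoint (φ q.1) q.2)) +
          inner ℂ (g p.1 p.2) (g q.1 q.2) := by
    rintro ⟨w, η⟩ ⟨z, ξ⟩
    have hne : 1 - ∑ i, w.1 i * star (z.1 i) ≠ 0 := by
      intro h0
      have h1 := (norm_sum_le Finset.univ fun i => w.1 i * star (z.1 i)).trans_lt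
        (sum_norm_mul_lt_one (mem_ball_zero_iff.1 z.2) (mem_ball_zero_iff.1 w.2))
      rw [← sub_eq_zero.1 h0] at h1
      simp at h1
    rw [inner_kern_left, inner_kern_left, eval_kern, eval_kern, inner_smul_right,
      inner_smul_right, h _ w.2 _ z.2, mul_add, inv_mul_cancel_left₀ hne]
  obtain ⟨L, hL⟩ := exists_clm_of_inner_eq_add
    (b := fun p : Metric.ball (0 : EuclideanSpace ℂ (Fin n)) 1 × F =>
      kern p.1 (adjoint (φ p.1) p.2)) denseRange_kernSum key
  -- The map `L` sends `k_z ⊗ η` to `k_z ⊗ φ(z)* η`, and pairing with these vectors evaluates at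
  -- `z`.
  refine ⟨adjoint L, fun f z hz => ext_inner_left ℂ fun η => ?_⟩
  rw [← inner_kern_left ⟨z, hz⟩, adjoint_inner_right, hL (⟨z, hz⟩, η), inner_kern_left,
    adjoint_inner_left]

end Multiplier

/-! ### Transfer functions of a single contraction -/

section Transfer

variable {K A : Type*} [NormedAddCommGroup K] [InnerProductSpace ℂ K] [CompleteSpace K]
  [NormedAddCommGroup A] [InnerProductSpace ℂ A] [CompleteSpace A]

/-- `θ = (-a + D_{a*} R Z D_a)|_{𝓓_a}`, where `a` is a contraction and `R = (I - Z a*)⁻¹`. -/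
def IsTransfer (a Z : K →L[ℂ] A) (R : A →L[ℂ] A)
    (θ : defectSpace a →L[ℂ] defectSpace (adjoint a)) : Prop :=
  ‖a‖ ≤ 1 ∧ (∀ h, R h - Z (adjoint a (R h)) = h) ∧ (∀ h, R (h - Z (adjoint a h)) = h) ∧
    ∀ x, (θ x : A) = (-a + defectOp (adjoint a) ∘L R ∘L Z ∘L defectOp a) x

namespace IsTransfer

variable {a Z : K →L[ℂ] A} {R : A →L[ℂ] A} {θ : defectSpace a →L[ℂ] defectSpace (adjoint a)}

lemma contraction (h : IsTransfer a Z R θ) : ‖a‖ ≤ 1 := h.1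

lemma right_inv (h : IsTransfer a Z R θ) (y : A) : R y - Z (adjoint a (R y)) = y := h.2.1 y

lemma left_inv (h : IsTransfer a Z R θ) (y : A) : R (y - Z (adjoint a y)) = y := h.2.2.1 y

lemma coe_apply (h : IsTransfer a Z R θ) (x : defectSpace a) :
    (θ x : A) = (-a + defectOp (adjoint a) ∘L R ∘L Z ∘L defectOp a) x := h.2.2.2 x

/-- `θ D_a = D_{a*} R (Z - a)`. -/
lemma apply_defectMap (h : IsTransfer a Z R θ) (x : K) :
    θ (defectMap a x) = defectMap (adjoint a) (R (Z x - a x)) := by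
  refine Subtype.ext ?_
  -- This gives `R a x = a x + R Z a* a x`, the identity that absorbs the term `-a` of `θ`.
  have h1 := h.left_inv (a x)
  rw [map_sub, sub_eq_iff_eq_add] at h1
  rw [h.coe_apply, coe_defectMap, coe_defectMap]
  simp only [add_apply, neg_apply, comp_apply, defectOp_sq h.contraction,
    map_defectOp h.contraction, map_sub, h1, map_add]
  abel

/-- `θ a* y = D_{a*} R D_{a*} y - y` for `y ∈ 𝓓_{a*}`. -/
lemma apply_adjoint (h : IsTransfer a Z R θ) {ρ : defectSpace (adjoint a) →L[ℂ] defectSpace a}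
    (hρ : ∀ y, (ρ y : K) = adjoint a (y : A)) (y : defectSpace (adjoint a)) :
    θ (ρ y) = defectMap (adjoint a) (R (defectIncl (adjoint a) y)) - y := by
  refine Subtype.ext ?_
  have ha' : ‖adjoint a‖ ≤ 1 := by simpa using h.contraction
  have h1 := h.left_inv (defectOp (adjoint a) (y : A))
  have h2 := map_defectOp ha' (y : A)
  have h3 := defectOp_sq ha' (y : A)
  rw [adjoint_adjoint] at h2 h3
  rw [map_sub, sub_eq_iff_eq_add] at h1
  rw [h.coe_apply, hρ, defectIncl_apply, AddSubgroupClass.coe_sub, coe_defectMap]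
  simp only [add_apply, neg_apply, comp_apply, ← h2]
  rw [h1, map_add, h3]
  abel

/-- `θ x = D_{a*} R Z D_a x - a x` for `x ∈ 𝓓_a`. -/
lemma apply_eq (h : IsTransfer a Z R θ) {κ : defectSpace a →L[ℂ] defectSpace (adjoint a)}
    (hκ : ∀ x, (κ x : A) = a (x : K)) (x : defectSpace a) :
    θ x = defectMap (adjoint a) (R (Z (defectIncl a x))) - κ x := by
  refine Subtype.ext ?_
  rw [h.coe_apply, defectIncl_apply, AddSubgroupClass.coe_sub, hκ, coe_defectMap]
  simp only [add_apply, neg_apply, comp_apply]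
  abel

end IsTransfer

end Transfer

/-! ### Characteristic functions are multipliers -/

section RowOperators

variable {n : ℕ} {H : Type*} [NormedAddCommGroup H] [InnerProductSpace ℂ H] [CompleteSpace H]

lemma row_apply (T : Fin n → H →L[ℂ] H) (x : PiLp 2 fun _ : Fin n => H) :
    row T x = ∑ i, T i (x i) := by
  simp [row]

lemma adjoint_row_apply (T : Fin n → H →L[ℂ] H) (h : H) :
    adjoint (row T) h = WithLp.toLp 2 fun i => adjoint (T i) h := by
  refine ext_inner_right ℂ fun x => ?_
  simp [adjoint_inner_left, row_apply, inner_sum, PiLp.inner_apply]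

lemma zRow_apply (z : EuclideanSpace ℂ (Fin n)) (x : PiLp 2 fun _ : Fin n => H) :
    zRow H z x = ∑ i, z i • x i := by
  simp [zRow, row_apply]

lemma adjoint_zRow_apply (z : EuclideanSpace ℂ (Fin n)) (h : H) :
    adjoint (zRow H z) h = WithLp.toLp 2 fun i => star (z i) • h := by
  refine ext_inner_right ℂ fun x => ?_
  simp [adjoint_inner_left, zRow_apply, inner_sum, PiLp.inner_apply, inner_smul_left,
    inner_smul_right]

lemma zRow_adjoint_zRow (w z : EuclideanSpace ℂ (Fin n)) (h : H) :
    zRow H z (adjoint (zRow H w) h) = (∑ i, z i * star (w i)) • h := by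
  simp [adjoint_zRow_apply, zRow_apply, smul_smul, Finset.sum_smul]

lemma zStar_eq (T : Fin n → H →L[ℂ] H) (z : EuclideanSpace ℂ (Fin n)) :
    zStar T z = zRow H z ∘L adjoint (row T) := by
  ext1 h
  simp [zStar, zRow_apply, adjoint_row_apply]

lemma norm_zRow_le (z : EuclideanSpace ℂ (Fin n)) : ‖zRow H z‖ ≤ ‖z‖ := by
  refine ContinuousLinearMap.opNorm_le_bound _ (norm_nonneg _) fun x => ?_
  rw [zRow_apply]
  calc ‖∑ i, z i • x i‖ ≤ ∑ i, ‖z i‖ * ‖x i‖ :=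
        (norm_sum_le _ _).trans_eq (by simp [norm_smul])
    _ ≤ √(∑ i, ‖z i‖ ^ 2) * √(∑ i, ‖x i‖ ^ 2) := Real.sum_mul_le_sqrt_mul_sqrt _ _ _
    _ = ‖z‖ * ‖x‖ := by rw [EuclideanSpace.norm_eq, PiLp.norm_eq_of_L2]

variable {T : Fin n → H →L[ℂ] H} {z : EuclideanSpace ℂ (Fin n)}

lemma isUnit_one_sub_zStar (hT : ‖row T‖ ≤ 1)
    (hz : z ∈ Metric.ball (0 : EuclideanSpace ℂ (Fin n)) 1) : IsUnit (1 - zStar T z) := by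
  refine isUnit_one_sub_of_norm_lt_one ?_
  rw [zStar_eq]
  rw [mem_ball_zero_iff] at hz
  calc _ ≤ ‖zRow H z‖ * ‖adjoint (row T)‖ := opNorm_comp_le _ _
    _ ≤ ‖z‖ * 1 := by
        gcongr
        · exact norm_zRow_le z
        · simpa using hT
    _ < 1 := by simpa using hz

lemma one_sub_zStar_inverse (hT : ‖row T‖ ≤ 1)
    (hz : z ∈ Metric.ball (0 : EuclideanSpace ℂ (Fin n)) 1) (h : H) :
    Ring.inverse (1 - zStar T z) h - zRow H z (adjoint (row T) (Ring.inverse (1 - zStar T z) h)) =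
      h := by
  have := congrArg (fun B : H →L[ℂ] H => B h)
    (Ring.mul_inverse_cancel _ (isUnit_one_sub_zStar hT hz))
  simpa [zStar_eq] using this

lemma inverse_one_sub_zStar (hT : ‖row T‖ ≤ 1)
    (hz : z ∈ Metric.ball (0 : EuclideanSpace ℂ (Fin n)) 1) (h : H) :
    Ring.inverse (1 - zStar T z) (h - zRow H z (adjoint (row T) h)) = h := by
  have := congrArg (fun B : H →L[ℂ] H => B h)
    (Ring.inverse_mul_cancel _ (isUnit_one_sub_zStar hT hz))
  simpa [zStar_eq] using this

lemma adjoint_preCharFun_apply (z : EuclideanSpace ℂ (Fin n)) (η : H) :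
    adjoint (preCharFun T z) η = defectOp (row T) (adjoint (zRow H z)
      (adjoint (Ring.inverse (1 - zStar T z)) (defectOp (adjoint (row T)) η))) -
        adjoint (row T) η := by
  simp [preCharFun, adjoint_comp, adjoint_defectOp, sub_eq_neg_add]

/-- `θ_T(z)` is a compression, so its adjoint is the compressed adjoint. No projection is needed,
because `T*` maps `𝓓_{T*}` into `𝓓_T`. -/
lemma coe_adjoint_charFun_apply (hT : ‖row T‖ ≤ 1) (z : EuclideanSpace ℂ (Fin n))
    (η : defectSpace (adjoint (row T))) :
    (adjoint (charFun T z) η : PiLp 2 fun _ : Fin n => H) = adjoint (preCharFun T z) η := by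
  have hT' : ‖adjoint (row T)‖ ≤ 1 := by simpa using hT
  have h : adjoint (preCharFun T z) η ∈ defectSpace (row T) := by
    rw [adjoint_preCharFun_apply]
    refine Submodule.sub_mem _ (defectOp_mem _ _) ?_
    have := map_mem_defectSpace hT' η.2
    rwa [adjoint_adjoint] at this
  have h2 : adjoint (charFun T z) η = ⟨_, h⟩ := by
    refine ext_inner_right ℂ fun x => ?_
    rw [adjoint_inner_left, Submodule.coe_inner, Submodule.coe_inner, coe_charFun_apply hT,
      adjoint_inner_left]
  rw [h2]

/-- The vector `(I - T W*)⁻¹ D_{T*} η`. -/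
noncomputable def stateVec (T : Fin n → H →L[ℂ] H) (w : EuclideanSpace ℂ (Fin n)) (η : H) : H :=
  adjoint (Ring.inverse (1 - zStar T w)) (defectOp (adjoint (row T)) η)

/-- Together with the formula for `θ_T(z)*`, this says that for `v = stateVec T z η` and `η` in
`𝓓_{T*}` the Julia operator of the row sends `(Z* v, η)` to `(v, θ_T(z)* η)`. -/
lemma stateVec_spec (hT : ‖row T‖ ≤ 1)
    (hz : z ∈ Metric.ball (0 : EuclideanSpace ℂ (Fin n)) 1) (η : H) :
    row T (adjoint (zRow H z) (stateVec T z η)) + defectOp (adjoint (row T)) η =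
      stateVec T z η := by
  refine ext_inner_right ℂ fun h => ?_
  rw [inner_add_left, ← adjoint_inner_right, ← adjoint_inner_right, adjoint_adjoint, stateVec,
    adjoint_inner_left, adjoint_inner_left, ← eq_sub_iff_add_eq', ← inner_sub_right, ← map_sub,
    inverse_one_sub_zStar hT hz]

/-- The Julia operator preserves the inner product of `(W* v_w, η)` and `(Z* v_z, ξ)`, where `v_w`,
`v_z` are the state vectors, and `⟨W* v_w, Z* v_z⟩` is the scalar `∑ wᵢ z̄ᵢ` times `⟨v_w, v_z⟩`. -/
lemma inner_sub_inner_adjoint_charFun (hT : ‖row T‖ ≤ 1) {w : EuclideanSpace ℂ (Fin n)}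
    (hw : w ∈ Metric.ball (0 : EuclideanSpace ℂ (Fin n)) 1)
    (hz : z ∈ Metric.ball (0 : EuclideanSpace ℂ (Fin n)) 1)
    (η ξ : defectSpace (adjoint (row T))) :
    inner ℂ η ξ = inner ℂ (adjoint (charFun T w) η) (adjoint (charFun T z) ξ) +
      (1 - ∑ i, w i * star (z i)) * inner ℂ (stateVec T w η) (stateVec T z ξ) := by
  have h := julia_inner hT (adjoint (zRow H w) (stateVec T w η))
    (adjoint (zRow H z) (stateVec T z ξ)) η ξ
  rw [stateVec_spec hT hw, stateVec_spec hT hz] at h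
  have h2 : inner ℂ (adjoint (zRow H w) (stateVec T w η)) (adjoint (zRow H z) (stateVec T z ξ)) =
      (∑ i, w i * star (z i)) * inner ℂ (stateVec T w η) (stateVec T z ξ) := by
    rw [adjoint_inner_left, zRow_adjoint_zRow, inner_smul_right]
  rw [h2] at h
  have e1 := (coe_adjoint_charFun_apply hT w η).trans (adjoint_preCharFun_apply w (η : H))
  have e2 := (coe_adjoint_charFun_apply hT z ξ).trans (adjoint_preCharFun_apply z (ξ : H))
  change _ = inner ℂ (adjoint (charFun T w) η : PiLp 2 fun _ : Fin n => H)
    (adjoint (charFun T z) ξ : PiLp 2 fun _ : Fin n => H) + _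
  rw [e1, e2]
  change inner ℂ (η : H) (ξ : H) = _
  simp only [stateVec] at h ⊢
  linear_combination -h

lemma exists_isMulOp_charFun (hT : ‖row T‖ ≤ 1) :
    ∃ M : Space n (defectSpace (row T)) →L[ℂ] Space n (defectSpace (adjoint (row T))),
      IsMulOp (charFun T) M :=
  exists_isMulOp_of_inner_eq (g := fun w η => stateVec T w (η : H)) fun _ hw _ hz η ξ =>
    inner_sub_inner_adjoint_charFun hT hw hz η ξ

lemma differentiableOn_charFun (hT : ‖row T‖ ≤ 1) :
    DifferentiableOn ℂ (charFun T) (Metric.ball 0 1) := by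
  intro z hz
  have h1 : DifferentiableAt ℂ (fun z => 1 - zStar T z) z := by
    unfold zStar
    fun_prop
  have hb : IsBoundedLinearMap ℂ (zRow (n := n) H) := by
    have hl : IsLinearMap ℂ (zRow (n := n) H) :=
      ⟨fun z w => by ext; simp [zRow_apply, add_smul, Finset.sum_add_distrib],
        fun c z => by ext; simp [zRow_apply, Finset.smul_sum, smul_smul]⟩
    exact hl.with_bound 1 fun z => by simpa using norm_zRow_le z
  have h2 : DifferentiableAt ℂ (zRow H) z :=
    IsBoundedLinearMap.differentiableAt (𝕜 := ℂ) (E := EuclideanSpace ℂ (Fin n))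
      (F := PiLp 2 (fun _ : Fin n => H) →L[ℂ] H) hb
  have h3 : DifferentiableAt ℂ (fun z => Ring.inverse (1 - zStar T z)) z :=
    DifferentiableAt.comp (g := Ring.inverse) z
      (differentiableAt_inverse (isUnit_one_sub_zStar hT hz)) h1
  refine DifferentiableAt.differentiableWithinAt ?_
  unfold charFun preCharFun
  fun_prop

lemma isMultiplier_charFun (hT : ‖row T‖ ≤ 1) : IsMultiplier (charFun T) :=
  ⟨differentiableOn_charFun hT, exists_isMulOp_charFun hT⟩

lemma isTransfer_charFun (hT : ‖row T‖ ≤ 1)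
    (hz : z ∈ Metric.ball (0 : EuclideanSpace ℂ (Fin n)) 1) :
    IsTransfer (row T) (zRow H z) (Ring.inverse (1 - zStar T z)) (charFun T z) :=
  ⟨hT, one_sub_zStar_inverse hT hz, inverse_one_sub_zStar hT hz, coe_charFun_apply hT z⟩

end RowOperators

set_option maxHeartbeats 1000000

/-! ### Julia unitaries and the abstract cascade -/

section Julia

variable {E F : Type*} [NormedAddCommGroup E] [InnerProductSpace ℂ E] [CompleteSpace E]
  [NormedAddCommGroup F] [InnerProductSpace ℂ F] [CompleteSpace F]

lemma denseRange_of_orthogonal {V : Type*} [AddCommGroup V] [Module ℂ V] (f : V →ₗ[ℂ] E)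
    (h : ∀ y, (∀ x, inner ℂ (f x) y = 0) → y = 0) : DenseRange f := by
  have h2 : (LinearMap.range f).topologicalClosure = ⊤ := by
    rw [Submodule.topologicalClosure_eq_top_iff, Submodule.eq_bot_iff]
    exact fun y hy => h y fun x => (Submodule.mem_orthogonal _ _).1 hy _ ⟨x, rfl⟩
  have := Submodule.dense_iff_topologicalClosure_eq_top.2 h2
  rwa [LinearMap.coe_range] at this

lemma eq_zero_of_denseRange {V : Type*} {f : V → E} (hf : DenseRange f) {y : E}
    (h : ∀ x, inner ℂ (f x) y = 0) : y = 0 :=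
  hf.eq_zero_of_inner_right (𝕜 := ℂ) h

lemma exists_unitary {V : Type*} [AddCommGroup V] [Module ℂ V] {e : V →ₗ[ℂ] E} {f : V →ₗ[ℂ] F}
    (he : DenseRange e) (hf : DenseRange f) (h : ∀ x, ‖f x‖ = ‖e x‖) :
    ∃ W : E ≃ₗᵢ[ℂ] F, ∀ x, W (e x) = f x :=
  ⟨(LinearEquiv.refl ℂ V).extendOfIsometry e f he hf h,
    LinearEquiv.extendOfIsometry_eq _ _ _ he hf h⟩

/-- The Julia unitary `[[L*, D_L], [D_{L*}, -L]] : F ⊕ 𝓓_L → E ⊕ 𝓓_{L*}` of a contraction. -/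
lemma exists_juliaUnitary {L : E →L[ℂ] F} (hL : ‖L‖ ≤ 1) :
    ∃ U : WithLp 2 (F × defectSpace L) ≃ₗᵢ[ℂ] WithLp 2 (E × defectSpace (adjoint L)),
      ∀ y, (U y).fst = adjoint L y.fst + defectOp L y.snd ∧
        ((U y).snd : F) = defectOp (adjoint L) y.fst - L y.snd := by
  have hL' : ‖adjoint L‖ ≤ 1 := by simpa using hL
  let L₁ : defectSpace L →L[ℂ] defectSpace (adjoint L) :=
    (L ∘L (defectSpace L).subtypeL).codRestrict _ fun x => map_mem_defectSpace hL x.2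
  let e := WithLp.prodContinuousLinearEquiv 2 ℂ E (defectSpace (adjoint L))
  let J : WithLp 2 (F × defectSpace L) →L[ℂ] WithLp 2 (E × defectSpace (adjoint L)) :=
    (e.symm : E × defectSpace (adjoint L) →L[ℂ] _) ∘L
      ((adjoint L ∘L WithLp.fstL 2 ℂ F (defectSpace L) +
        (defectOp L ∘L (defectSpace L).subtypeL) ∘L WithLp.sndL 2 ℂ F (defectSpace L)).prod
      (defectMap (adjoint L) ∘L WithLp.fstL 2 ℂ F (defectSpace L) -
        L₁ ∘L WithLp.sndL 2 ℂ F (defectSpace L)))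
  have hJ1 : ∀ y, (J y).fst = adjoint L y.fst + defectOp L y.snd := fun y => rfl
  have hJ2 : ∀ y, ((J y).snd : F) = defectOp (adjoint L) y.fst - L y.snd := fun y => rfl
  have hnorm : ∀ y, ‖J y‖ = ‖y‖ := by
    intro y
    have h := julia_norm hL' y.fst (y.snd : E)
    rw [adjoint_adjoint, ← hJ1, ← hJ2] at h
    rw [← sq_eq_sq₀ (norm_nonneg _) (norm_nonneg _), WithLp.prod_norm_sq_eq_of_L2,
      WithLp.prod_norm_sq_eq_of_L2]
    exact h
  have hsurj : Function.Surjective J := by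
    intro w
    have hm : defectOp L w.fst - adjoint L (w.snd : F) ∈ defectSpace L := by
      refine Submodule.sub_mem _ (defectOp_mem _ _) ?_
      have := map_mem_defectSpace hL' w.snd.2
      rwa [adjoint_adjoint] at this
    -- The preimage comes from the adjoint matrix `[[L, D_{L*}], [D_L, -L*]]`.
    refine ⟨WithLp.toLp 2 (L w.fst + defectOp (adjoint L) w.snd, ⟨_, hm⟩), ?_⟩
    have h1 := map_defectOp hL' (w.snd : F)
    have h2 := defectOp_sq hL' (w.snd : F)
    rw [adjoint_adjoint] at h1 h2
    refine WithLp.ofLp_injective 2 (Prod.ext ?_ (Subtype.ext ?_))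
    · change (J _).fst = w.fst
      rw [hJ1]
      simp [defectOp_sq hL, h1]
    · change ((J _).snd : F) = w.snd
      rw [hJ2]
      simp [h2, map_defectOp hL]
  exact ⟨LinearIsometryEquiv.ofSurjective ⟨J.toLinearMap, hnorm⟩ hsurj, fun y => ⟨hJ1 y, hJ2 y⟩⟩

variable {V₁ V₂ P : Type*} [AddCommGroup V₁] [Module ℂ V₁] [AddCommGroup V₂] [Module ℂ V₂]
  [NormedAddCommGroup P] [InnerProductSpace ℂ P] [CompleteSpace P]

/-- The map `(u, v) ↦ (δ₁ u - ρ L δ₂ v, D_L δ₂ v)`. -/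
noncomputable def blockDefect (δ₁ : V₁ →ₗ[ℂ] P) (ρ : F →L[ℂ] P) (L : E →L[ℂ] F)
    (δ₂ : V₂ →ₗ[ℂ] E) : V₁ × V₂ →ₗ[ℂ] WithLp 2 (P × defectSpace L) :=
  ((WithLp.linearEquiv 2 ℂ (P × defectSpace L)).symm : P × defectSpace L →ₗ[ℂ] _) ∘ₗ
    ((δ₁ ∘ₗ LinearMap.fst ℂ V₁ V₂ - ρ.toLinearMap ∘ₗ L.toLinearMap ∘ₗ δ₂ ∘ₗ
      LinearMap.snd ℂ V₁ V₂).prod ((defectMap L).toLinearMap ∘ₗ δ₂ ∘ₗ LinearMap.snd ℂ V₁ V₂))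

lemma blockDefect_apply (δ₁ : V₁ →ₗ[ℂ] P) (ρ : F →L[ℂ] P) (L : E →L[ℂ] F)
    (δ₂ : V₂ →ₗ[ℂ] E) (x : V₁ × V₂) : blockDefect δ₁ ρ L δ₂ x =
      WithLp.toLp 2 (δ₁ x.1 - ρ (L (δ₂ x.2)), defectMap L (δ₂ x.2)) := rfl

lemma norm_blockDefect_sq (δ₁ : V₁ →ₗ[ℂ] P) (ρ : F →L[ℂ] P) {L : E →L[ℂ] F} (hL : ‖L‖ ≤ 1)
    (δ₂ : V₂ →ₗ[ℂ] E) (x : V₁ × V₂) : ‖blockDefect δ₁ ρ L δ₂ x‖ ^ 2 =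
      ‖δ₁ x.1 - ρ (L (δ₂ x.2))‖ ^ 2 + (‖δ₂ x.2‖ ^ 2 - ‖L (δ₂ x.2)‖ ^ 2) := by
  rw [blockDefect_apply, WithLp.prod_norm_sq_eq_of_L2, ← norm_defectOp_sq hL]
  rfl

lemma denseRange_blockDefect {δ₁ : V₁ →ₗ[ℂ] P} (ρ : F →L[ℂ] P) (L : E →L[ℂ] F)
    {δ₂ : V₂ →ₗ[ℂ] E} (h₁ : DenseRange δ₁) (h₂ : DenseRange δ₂) :
    DenseRange (blockDefect δ₁ ρ L δ₂) := by
  refine denseRange_of_orthogonal _ fun y hy => ?_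
  simp only [blockDefect_apply, WithLp.prod_inner_apply] at hy
  -- The map is triangular: testing against `(u, 0)` kills the first component, after which the `ρ`
  -- term no longer matters.
  have hy1 : y.fst = 0 := eq_zero_of_denseRange h₁ fun u => by simpa using hy (u, 0)
  have hy2 : y.snd = 0 := by
    refine eq_zero_of_denseRange ((denseRange_defectMap L).comp h₂ (defectMap L).continuous)
      fun v => ?_
    have := hy (0, v)
    change inner ℂ _ y.fst + inner ℂ _ y.snd = 0 at this
    rw [hy1, inner_zero_right, zero_add] at this
    exact this
  exact WithLp.ofLp_injective 2 (Prod.ext hy1 hy2)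

/-- The hypothesis `h` is equality of norms on the dense range of `δ`. The lemma serves both defect
spaces of a block matrix. -/
lemma exists_blockUnitary {V D : Type*} [AddCommGroup V] [Module ℂ V]
    [NormedAddCommGroup D] [InnerProductSpace ℂ D] [CompleteSpace D]
    {δ : V →ₗ[ℂ] D} {σ : V ≃ₗ[ℂ] V₁ × V₂} {δ₁ : V₁ →ₗ[ℂ] P} {ρ : F →L[ℂ] P} {L : E →L[ℂ] F}
    {δ₂ : V₂ →ₗ[ℂ] E} (hδ : DenseRange δ) (h₁ : DenseRange δ₁) (h₂ : DenseRange δ₂) (hL : ‖L‖ ≤ 1)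
    (h : ∀ u v, ‖δ₁ u - ρ (L (δ₂ v))‖ ^ 2 + (‖δ₂ v‖ ^ 2 - ‖L (δ₂ v)‖ ^ 2) =
      ‖δ (σ.symm (u, v))‖ ^ 2) :
    ∃ W : D ≃ₗᵢ[ℂ] WithLp 2 (P × defectSpace L), ∀ x, W (δ x) = blockDefect δ₁ ρ L δ₂ (σ x) := by
  refine exists_unitary (f := blockDefect δ₁ ρ L δ₂ ∘ₗ σ.toLinearMap) hδ ?_ fun x => ?_
  · have := denseRange_blockDefect ρ L h₁ h₂
    rw [DenseRange, ← LinearMap.coe_range, LinearMap.range_comp, LinearEquiv.range,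
      Submodule.map_top, LinearMap.coe_range]
    exact this
  · rw [← sq_eq_sq₀ (norm_nonneg _) (norm_nonneg _)]
    refine (norm_blockDefect_sq δ₁ ρ hL δ₂ (σ x)).trans ?_
    rw [h, Prod.mk.eta, σ.symm_apply_apply]

/-- The Julia unitary takes `(m + L q, D_L q)` to `(L* m + q, D_{L*} m)`: the two defect identities
for `L` cancel everything else. So `q` and `m` are the signals exchanged between the two factors. -/
lemma diagOne_julia_diagOne {Q : Type*} [NormedAddCommGroup Q] [InnerProductSpace ℂ Q]
    {L : E →L[ℂ] F} (hL : ‖L‖ ≤ 1)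
    {U : WithLp 2 (F × defectSpace L) ≃ₗᵢ[ℂ] WithLp 2 (E × defectSpace (adjoint L))}
    (hU : ∀ y, (U y).fst = adjoint L y.fst + defectOp L y.snd ∧
      ((U y).snd : F) = defectOp (adjoint L) y.fst - L y.snd)
    {θ₁ : P →L[ℂ] F} {θ₂ : E →L[ℂ] Q} {p : P} {q : E} {m : F} {r : Q}
    (h₁ : θ₁ p = m + L q) (h₂ : θ₂ (adjoint L m + q) = r) :
    diagOne θ₂ _ (U (diagOne θ₁ _ (WithLp.toLp 2 (p, defectMap L q)))) =
      WithLp.toLp 2 (r, defectMap (adjoint L) m) := by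
  rw [diagOne_apply, diagOne_apply]
  change WithLp.toLp 2 (θ₂ (U (WithLp.toLp 2 (θ₁ p, defectMap L q))).fst,
    (U (WithLp.toLp 2 (θ₁ p, defectMap L q))).snd) = _
  rw [h₁]
  have e1 : (U (WithLp.toLp 2 (m + L q, defectMap L q))).fst = adjoint L m + q := by
    rw [(hU _).1]
    simp [defectOp_sq hL]
  have e2 : (U (WithLp.toLp 2 (m + L q, defectMap L q))).snd = defectMap (adjoint L) m := by
    refine Subtype.ext ?_
    rw [(hU _).2]
    simp [map_defectOp hL]
  rw [e1, e2, h₂]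

lemma norm_sub_coe {p : Submodule ℂ E} (a b : p) : ‖a - b‖ = ‖(a : E) - b‖ := rfl

lemma factorization_of_dense {V D Ds Q : Type*}
    [NormedAddCommGroup D] [InnerProductSpace ℂ D] [NormedAddCommGroup Ds] [InnerProductSpace ℂ Ds]
    [NormedAddCommGroup Q] [InnerProductSpace ℂ Q] {L : E →L[ℂ] F} (hL : ‖L‖ ≤ 1)
    {U : WithLp 2 (F × defectSpace L) ≃ₗᵢ[ℂ] WithLp 2 (E × defectSpace (adjoint L))}
    (hU : ∀ y, (U y).fst = adjoint L y.fst + defectOp L y.snd ∧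
      ((U y).snd : F) = defectOp (adjoint L) y.fst - L y.snd)
    (W : D ≃ₗᵢ[ℂ] WithLp 2 (P × defectSpace L))
    (Ws : Ds ≃ₗᵢ[ℂ] WithLp 2 (Q × defectSpace (adjoint L)))
    {δ : V → D} (hδ : DenseRange δ) {θ : D →L[ℂ] Ds} {θ₁ : P →L[ℂ] F} {θ₂ : E →L[ℂ] Q}
    (h : ∀ k, ∃ p q m r, W (δ k) = WithLp.toLp 2 (p, defectMap L q) ∧
      Ws (θ (δ k)) = WithLp.toLp 2 (r, defectMap (adjoint L) m) ∧
      θ₁ p = m + L q ∧ θ₂ (adjoint L m + q) = r) (d : D) :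
    Ws (θ d) = diagOne θ₂ _ (U (diagOne θ₁ _ (W d))) := by
  refine hδ.induction_on (p := fun d => Ws (θ d) = diagOne θ₂ _ (U (diagOne θ₁ _ (W d)))) d
    (isClosed_eq (Ws.continuous.comp θ.continuous) ((diagOne θ₂ _).continuous.comp
      (U.continuous.comp ((diagOne θ₁ _).continuous.comp W.continuous)))) fun k => ?_
  obtain ⟨p, q, m, r, h1, h2, h3, h4⟩ := h k
  rw [h1, h2]
  exact (diagOne_julia_diagOne hL hU h3 h4).symm

end Julia

/-! ### The corner of a triangular contraction -/

section BlockContraction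

variable {K₁ K₂ A B : Type*} [NormedAddCommGroup K₁] [InnerProductSpace ℂ K₁] [CompleteSpace K₁]
  [NormedAddCommGroup K₂] [InnerProductSpace ℂ K₂] [CompleteSpace K₂]
  [NormedAddCommGroup A] [InnerProductSpace ℂ A] [CompleteSpace A]
  [NormedAddCommGroup B] [InnerProductSpace ℂ B] [CompleteSpace B]

/-- A form of Douglas' lemma: `D_g x ↦ f x` is well defined and contractive on a dense subspace of
`𝓓_g`. -/
lemma exists_comp_defectMap_eq {f : K₁ →L[ℂ] K₂} {g : K₁ →L[ℂ] B}
    (h : ∀ x, ‖f x‖ ≤ ‖defectOp g x‖) :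
    ∃ L : defectSpace g →L[ℂ] K₂, ‖L‖ ≤ 1 ∧ ∀ x, L (defectMap g x) = f x := by
  have hd : DenseRange (defectMap g).toLinearMap := denseRange_defectMap g
  have h' : ∀ x, ‖f.toLinearMap x‖ ≤ 1 * ‖(defectMap g).toLinearMap x‖ := fun x => by
    simpa using h x
  exact ⟨f.toLinearMap.extendOfNorm (defectMap g).toLinearMap,
    LinearMap.opNorm_extendOfNorm_le hd zero_le_one h', LinearMap.extendOfNorm_eq hd ⟨1, h'⟩⟩

set_option maxHeartbeats 1000000 in
/-- The corner `X` of a contraction `[[S, X], [0, C]]` has the form `X = D_{S*} L D_C`. -/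
lemma exists_corner_factorization {s : K₁ →L[ℂ] A} {x : K₂ →L[ℂ] A} {c : K₂ →L[ℂ] B}
    (hs : ‖s‖ ≤ 1) (hc : ‖c‖ ≤ 1)
    (h : ∀ u v, ‖s u + x v‖ ^ 2 + ‖c v‖ ^ 2 ≤ ‖u‖ ^ 2 + ‖v‖ ^ 2) :
    ∃ L : defectSpace c →L[ℂ] defectSpace (adjoint s), ‖L‖ ≤ 1 ∧
      ∀ v, x v = defectIncl (adjoint s) (L (defectMap c v)) := by
  have hs' : ‖adjoint s‖ ≤ 1 := by simpa using hs
  -- Ignoring `c`, the row `[s, x]` is a contraction, so `s s* + x x* ≤ I`. This gives `x = D_{s*}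
  -- K'*` for some `K'`.
  have h1 : ∀ y, ‖adjoint x y‖ ≤ ‖defectOp (adjoint s) y‖ := by
    intro y
    have e1 : inner ℂ y (s (adjoint s y) + x (adjoint x y)) =
        ((‖adjoint s y‖ ^ 2 + ‖adjoint x y‖ ^ 2 : ℝ) : ℂ) := by
      rw [inner_add_right, ← adjoint_inner_left s, ← adjoint_inner_left x, inner_self_eq_norm_sq_to_K,
        inner_self_eq_norm_sq_to_K]
      simp
    have e2 := norm_inner_le_norm (𝕜 := ℂ) y (s (adjoint s y) + x (adjoint x y))
    rw [e1, Complex.norm_of_nonneg (by positivity)] at e2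
    have e3 := h (adjoint s y) (adjoint x y)
    have e4 : ‖adjoint s y‖ ^ 2 + ‖adjoint x y‖ ^ 2 ≤ ‖y‖ ^ 2 := by
      set m := ‖adjoint s y‖ ^ 2 + ‖adjoint x y‖ ^ 2 with hm
      have hm0 : 0 ≤ m := by positivity
      rcases hm0.eq_or_lt with h0 | h0
      · rw [← h0]; positivity
      · have : m * m ≤ ‖y‖ ^ 2 * m := by
          calc m * m ≤ (‖y‖ * ‖s (adjoint s y) + x (adjoint x y)‖) *
                (‖y‖ * ‖s (adjoint s y) + x (adjoint x y)‖) := by gcongr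
            _ = ‖y‖ ^ 2 * ‖s (adjoint s y) + x (adjoint x y)‖ ^ 2 := by ring
            _ ≤ ‖y‖ ^ 2 * m := by
              gcongr
              nlinarith [sq_nonneg ‖c (adjoint x y)‖]
        exact le_of_mul_le_mul_right this h0
    rw [← sq_le_sq₀ (norm_nonneg _) (norm_nonneg _), norm_defectOp_sq hs']
    linarith
  obtain ⟨K', -, hK'⟩ := exists_comp_defectMap_eq h1
  have hx : ∀ v, x v = defectOp (adjoint s) (adjoint K' v : defectSpace (adjoint s)) := by
    intro v
    refine ext_inner_left ℂ fun y => ?_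
    rw [← inner_defectOp_left, ← adjoint_inner_left, ← hK', ← adjoint_inner_right]
    rfl
  have h2 : ∀ v, ‖adjoint K' v‖ ≤ ‖defectOp c v‖ := by
    intro v
    set y := adjoint K' v
    have hmem : adjoint s (y : A) ∈ defectSpace s := by
      have := map_mem_defectSpace hs' y.2
      rwa [adjoint_adjoint] at this
    -- Subtract the contraction inequality at `(u, v)` from the Julia identity of `s` at `(u, y)`;
    -- both contain `‖s u + D_{s*} y‖²`. Since `s* y` lies in `𝓓_s`, a suitable `u` makes the last
    -- term arbitrarily small.
    have key : ∀ u, ‖y‖ ^ 2 ≤ ‖defectOp c v‖ ^ 2 + ‖defectOp s u - adjoint s (y : A)‖ ^ 2 := by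
      intro u
      have e1 := julia_norm hs u (y : A)
      have e2 := h u v
      rw [hx v] at e2
      rw [norm_defectOp_sq hc]
      have e3 : ‖y‖ = ‖(y : A)‖ := rfl
      rw [e3]
      linarith
    rw [← sq_le_sq₀ (norm_nonneg _) (norm_nonneg _)]
    refine le_of_forall_pos_le_add fun ε hε => ?_
    obtain ⟨_, ⟨u, rfl⟩, hu⟩ := Metric.mem_closure_iff.1 hmem (Real.sqrt ε) (Real.sqrt_pos.2 hε)
    refine (key u).trans ?_
    gcongr
    rw [dist_comm, dist_eq_norm] at hu
    calc _ ≤ Real.sqrt ε ^ 2 := by gcongr; exact hu.le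
      _ = ε := Real.sq_sqrt hε.le
  obtain ⟨L, hL, hL2⟩ := exists_comp_defectMap_eq h2
  exact ⟨L, hL, fun v => by rw [hL2, hx, defectIncl_apply]⟩

end BlockContraction

namespace IsTransfer
section
variable {K A : Type*} [NormedAddCommGroup K] [InnerProductSpace ℂ K] [CompleteSpace K]
  [NormedAddCommGroup A] [InnerProductSpace ℂ A] [CompleteSpace A]
  {a Z : K →L[ℂ] A} {R : A →L[ℂ] A} {θ : defectSpace a →L[ℂ] defectSpace (adjoint a)}

/-- Supplies the relation `θ₁ p = m + L q` of the cascade, with `y = L q` and `m = D_{a*} v`. -/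
lemma apply_defectMap_sub (h : IsTransfer a Z R θ)
    {ρ : defectSpace (adjoint a) →L[ℂ] defectSpace a}
    (hρ : ∀ y, (ρ y : K) = adjoint a (y : A)) (u : K) (y : defectSpace (adjoint a)) {v : A}
    (hv : v = R (Z u - a u - defectIncl (adjoint a) y)) :
    θ (defectMap a u - ρ y) = defectMap (adjoint a) v + y := by
  rw [map_sub θ, h.apply_defectMap, h.apply_adjoint hρ, hv, map_sub R (Z u - a u),
    map_sub (defectMap (adjoint a))]
  abel

/-- Supplies the relation `θ₂ (L* m + q) = r` of the cascade, with `y = L* m` and `q = D_a u`. -/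
lemma apply_add_defectMap (h : IsTransfer a Z R θ)
    {κ : defectSpace a →L[ℂ] defectSpace (adjoint a)} (hκ : ∀ x, (κ x : A) = a (x : K))
    (y : defectSpace a) (u : K) {v : A} (hv : v = R (Z u - a u + Z (defectIncl a y))) :
    θ (y + defectMap a u) = defectMap (adjoint a) v - κ y := by
  rw [map_add θ, h.apply_defectMap, h.apply_eq hκ, hv, map_add R, map_add (defectMap (adjoint a))]
  abel
end
end IsTransfer

/-! ### Factorization for a two-by-two triangular contraction -/

section BlockTriangular

universe u₁ u₂

variable {K K₁ G B : Type*} {A : Type u₁} {K₂ : Type u₂}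
  [NormedAddCommGroup G] [InnerProductSpace ℂ G] [CompleteSpace G]
  [NormedAddCommGroup K] [InnerProductSpace ℂ K] [CompleteSpace K]
  [NormedAddCommGroup K₁] [InnerProductSpace ℂ K₁] [CompleteSpace K₁]
  [NormedAddCommGroup K₂] [InnerProductSpace ℂ K₂] [CompleteSpace K₂]
  [NormedAddCommGroup A] [InnerProductSpace ℂ A] [CompleteSpace A]
  [NormedAddCommGroup B] [InnerProductSpace ℂ B] [CompleteSpace B]

/-- The linear isomorphism `σ` identifies `K` with the orthogonal sum of `K₁` and `K₂`. -/
def IsOrthogonalSum {K K₁ K₂ : Type*} [NormedAddCommGroup K] [InnerProductSpace ℂ K]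
    [NormedAddCommGroup K₁] [InnerProductSpace ℂ K₁] [NormedAddCommGroup K₂]
    [InnerProductSpace ℂ K₂] (σ : K ≃ₗ[ℂ] K₁ × K₂) : Prop :=
  ∀ k l, inner ℂ k l = inner ℂ (σ k).1 (σ l).1 + inner ℂ (σ k).2 (σ l).2

lemma IsOrthogonalSum.norm_sq {σ : K ≃ₗ[ℂ] K₁ × K₂} (h : IsOrthogonalSum σ) (k : K) :
    ‖k‖ ^ 2 = ‖(σ k).1‖ ^ 2 + ‖(σ k).2‖ ^ 2 := by
  have h1 := congrArg Complex.re (h k k)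
  rw [Complex.add_re] at h1
  simpa only [← RCLike.re_eq_complex_re, inner_self_eq_norm_sq] using h1

/-- `t = [[s, x], [0, c]]` with respect to `K = K₁ ⊕ K₂` and `G = A ⊕ B`. -/
def IsBlock (σ : K ≃ₗ[ℂ] K₁ × K₂) (τ : G ≃ₗ[ℂ] A × B) (t : K →L[ℂ] G) (s : K₁ →L[ℂ] A)
    (x : K₂ →L[ℂ] A) (c : K₂ →L[ℂ] B) : Prop :=
  IsOrthogonalSum σ ∧ IsOrthogonalSum τ ∧
    ∀ k, τ (t k) = (s (σ k).1 + x (σ k).2, c (σ k).2)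

namespace IsBlock

variable {σ : K ≃ₗ[ℂ] K₁ × K₂} {τ : G ≃ₗ[ℂ] A × B} {t : K →L[ℂ] G} {s : K₁ →L[ℂ] A}
  {x : K₂ →L[ℂ] A} {c : K₂ →L[ℂ] B}

lemma dom (h : IsBlock σ τ t s x c) : IsOrthogonalSum σ := h.1

lemma cod (h : IsBlock σ τ t s x c) : IsOrthogonalSum τ := h.2.1

lemma apply_eq (h : IsBlock σ τ t s x c) (k : K) :
    τ (t k) = (s (σ k).1 + x (σ k).2, c (σ k).2) := h.2.2 k

lemma adjoint_apply (h : IsBlock σ τ t s x c) (y : G) :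
    σ (adjoint t y) = (adjoint s (τ y).1, adjoint x (τ y).1 + adjoint c (τ y).2) := by
  rw [← σ.eq_symm_apply]
  refine ext_inner_right ℂ fun k => ?_
  rw [adjoint_inner_left, h.cod, h.apply_eq, h.dom]
  simp only [LinearEquiv.apply_symm_apply, inner_add_left, inner_add_right, adjoint_inner_left]
  ring

lemma norm_sq_le (h : IsBlock σ τ t s x c) (ht : ‖t‖ ≤ 1) (u : K₁) (v : K₂) :
    ‖s u + x v‖ ^ 2 + ‖c v‖ ^ 2 ≤ ‖u‖ ^ 2 + ‖v‖ ^ 2 := by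
  have h1 := t.le_of_opNorm_le ht (σ.symm (u, v))
  rw [one_mul, ← sq_le_sq₀ (norm_nonneg _) (norm_nonneg _), h.dom.norm_sq, h.cod.norm_sq, h.apply_eq] at h1
  simpa using h1

lemma contraction_fst (h : IsBlock σ τ t s x c) (ht : ‖t‖ ≤ 1) : ‖s‖ ≤ 1 := by
  refine opNorm_le_bound _ zero_le_one fun u => ?_
  rw [one_mul, ← sq_le_sq₀ (norm_nonneg _) (norm_nonneg _)]
  simpa using h.norm_sq_le ht u 0

lemma contraction_snd (h : IsBlock σ τ t s x c) (ht : ‖t‖ ≤ 1) : ‖c‖ ≤ 1 := by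
  refine opNorm_le_bound _ zero_le_one fun v => ?_
  rw [one_mul, ← sq_le_sq₀ (norm_nonneg _) (norm_nonneg _)]
  have := h.norm_sq_le ht 0 v
  simp only [norm_zero, map_zero, zero_add] at this
  nlinarith [sq_nonneg ‖x v‖]

variable {L : defectSpace c →L[ℂ] defectSpace (adjoint s)}

lemma adjoint_corner_eq (hx : ∀ v, x v = defectIncl (adjoint s) (L (defectMap c v))) (a : A) :
    adjoint x a = defectIncl c (adjoint L (defectMap (adjoint s) a)) := by
  refine ext_inner_right ℂ fun v => ?_
  rw [adjoint_inner_left, hx, ← inner_defectMap_left, ← adjoint_inner_left L,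
    inner_defectMap_right]

lemma exists_unitary_defectSpace (h : IsBlock σ τ t s x c) (ht : ‖t‖ ≤ 1) (hL : ‖L‖ ≤ 1)
    (hx : ∀ v, x v = defectIncl (adjoint s) (L (defectMap c v)))
    {ρ : defectSpace (adjoint s) →L[ℂ] defectSpace s}
    (hρ : ∀ y, (ρ y : K₁) = adjoint s (y : A)) :
    ∃ W : defectSpace t ≃ₗᵢ[ℂ] WithLp 2 (defectSpace s × defectSpace L),
      ∀ k, W (defectMap t k) =
        blockDefect (defectMap s).toLinearMap ρ L (defectMap c).toLinearMap (σ k) := by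
  refine exists_blockUnitary (δ := (defectMap t).toLinearMap) (denseRange_defectMap _)
    (denseRange_defectMap _) (denseRange_defectMap _) hL fun u v => ?_
  have e1 := norm_defectMap_sq ht (σ.symm (u, v))
  rw [h.dom.norm_sq, h.cod.norm_sq, h.apply_eq] at e1
  simp only [LinearEquiv.apply_symm_apply] at e1
  have e2 := norm_defectMap_sq (h.contraction_snd ht) v
  -- With `y = L D_c v` and `x v = D_{s*} y`, the Julia identity of `s` replaces `‖u‖² - ‖s u + x
  -- v‖²` by `‖D_s u - s* y‖² - ‖y‖²`.
  have e3 := julia_norm (h.contraction_fst ht) u (L (defectMap c v) : A)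
  have e4 := hx v
  rw [defectIncl_apply] at e4
  rw [← e4, ← hρ] at e3
  have e5 := norm_sub_coe (defectMap s u) (ρ (L (defectMap c v)))
  have e6 := Submodule.norm_coe (L (defectMap c v))
  simp only [coe_coe]
  rw [e1, e2, e5, ← e6, coe_defectMap]
  linarith

lemma exists_unitary_defectSpace_adjoint (h : IsBlock σ τ t s x c) (ht : ‖t‖ ≤ 1) (hL : ‖L‖ ≤ 1)
    (hx : ∀ v, x v = defectIncl (adjoint s) (L (defectMap c v)))
    {κ : defectSpace c →L[ℂ] defectSpace (adjoint c)} (hκ : ∀ y, (κ y : B) = c (y : K₂)) :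
    ∃ W : defectSpace (adjoint t) ≃ₗᵢ[ℂ]
        WithLp 2 (defectSpace (adjoint c) × defectSpace (adjoint L)),
      ∀ y, W (defectMap (adjoint t) y) = blockDefect (defectMap (adjoint c)).toLinearMap κ
        (adjoint L) (defectMap (adjoint s)).toLinearMap ((τ y).2, (τ y).1) := by
  have ht' : ‖adjoint t‖ ≤ 1 := by simpa using ht
  have hs' : ‖adjoint s‖ ≤ 1 := by simpa using h.contraction_fst ht
  have hc' : ‖adjoint c‖ ≤ 1 := by simpa using h.contraction_snd ht
  have hL' : ‖adjoint L‖ ≤ 1 := by simpa using hL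
  refine exists_blockUnitary (δ := (defectMap (adjoint t)).toLinearMap)
    -- The adjoint of `t` is lower triangular, so the summands are swapped: `c*` now plays the role
    -- of `s`, and `L*` that of `L`.
    (σ := τ.trans (LinearEquiv.prodComm ℂ A B))
    (denseRange_defectMap _) (denseRange_defectMap _) (denseRange_defectMap _) hL' fun b a => ?_
  have e1 := norm_defectMap_sq ht' (τ.symm (a, b))
  rw [h.cod.norm_sq, h.dom.norm_sq, h.adjoint_apply] at e1
  simp only [LinearEquiv.apply_symm_apply] at e1
  have e2 := norm_defectMap_sq hs' a
  have e3 := julia_norm hc' b (adjoint L (defectMap (adjoint s) a) : K₂)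
  have e4 := adjoint_corner_eq hx a
  rw [defectIncl_apply] at e4
  rw [adjoint_adjoint, ← e4, ← hκ] at e3
  have e5 := norm_sub_coe (defectMap (adjoint c) b) (κ (adjoint L (defectMap (adjoint s) a)))
  have e6 := Submodule.norm_coe (adjoint L (defectMap (adjoint s) a))
  simp only [coe_coe]
  change _ = ‖defectMap (adjoint t) (τ.symm (a, b))‖ ^ 2
  rw [e1, e2, e5, ← e6, coe_defectMap, add_comm (adjoint x a)]
  linarith

variable {Z : K →L[ℂ] G} {Z₁ : K₁ →L[ℂ] A} {Z₂ : K₂ →L[ℂ] B}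
  {R : G →L[ℂ] G} {R₁ : A →L[ℂ] A} {R₂ : B →L[ℂ] B}
  {θ : defectSpace t →L[ℂ] defectSpace (adjoint t)}
  {θ₁ : defectSpace s →L[ℂ] defectSpace (adjoint s)}
  {θ₂ : defectSpace c →L[ℂ] defectSpace (adjoint c)}

/-- The state equations of the cascade of two transfer functions. -/
lemma state_equations (h : IsBlock σ τ t s x c)
    (hZ : ∀ k, τ (Z k) = (Z₁ (σ k).1, Z₂ (σ k).2))
    (hθ : IsTransfer t Z R θ) (hθ₁ : IsTransfer s Z₁ R₁ θ₁) (hθ₂ : IsTransfer c Z₂ R₂ θ₂)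
    (k : K) {v : G} (hv : v = R (Z k - t k)) :
    (τ v).1 = R₁ (Z₁ (σ k).1 - s (σ k).1 - x (σ k).2) ∧
      (τ v).2 = R₂ (Z₂ (σ k).2 - c (σ k).2 + Z₂ (adjoint x (τ v).1)) := by
  -- This is `(I - Z t*) v = (Z - t) k` read in both components. The second equation is driven by
  -- the first through `Z₂ x* v₁`.
  have e := congrArg τ (hθ.right_inv (Z k - t k))
  rw [← hv, map_sub, map_sub, hZ, hZ, h.adjoint_apply, h.apply_eq] at e
  have e1 : (τ v).1 - Z₁ (adjoint s (τ v).1) = Z₁ (σ k).1 - (s (σ k).1 + x (σ k).2) :=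
    congrArg Prod.fst e
  have e2 : (τ v).2 - Z₂ (adjoint x (τ v).1 + adjoint c (τ v).2) = Z₂ (σ k).2 - c (σ k).2 :=
    congrArg Prod.snd e
  constructor
  · rw [sub_sub, ← e1, hθ₁.left_inv]
  · rw [← e2, map_add Z₂, ← sub_sub, sub_right_comm, sub_add_cancel, hθ₂.left_inv]

/-- The transfer function of a block triangular contraction factors into those of its diagonal
entries. -/
theorem exists_transfer_factorization (h : IsBlock σ τ t s x c) (ht : ‖t‖ ≤ 1) :
    ∃ (P : Type u₂) (_ : NormedAddCommGroup P) (_ : InnerProductSpace ℂ P) (_ : CompleteSpace P)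
      (Q : Type u₁) (_ : NormedAddCommGroup Q) (_ : InnerProductSpace ℂ Q) (_ : CompleteSpace Q)
      (U : WithLp 2 (defectSpace (adjoint s) × P) ≃ₗᵢ[ℂ] WithLp 2 (defectSpace c × Q))
      (W : defectSpace t ≃ₗᵢ[ℂ] WithLp 2 (defectSpace s × P))
      (Ws : defectSpace (adjoint t) ≃ₗᵢ[ℂ] WithLp 2 (defectSpace (adjoint c) × Q)),
      ∀ (Z : K →L[ℂ] G) (Z₁ : K₁ →L[ℂ] A) (Z₂ : K₂ →L[ℂ] B)
        (R : G →L[ℂ] G) (R₁ : A →L[ℂ] A) (R₂ : B →L[ℂ] B)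
        (θ : defectSpace t →L[ℂ] defectSpace (adjoint t))
        (θ₁ : defectSpace s →L[ℂ] defectSpace (adjoint s))
        (θ₂ : defectSpace c →L[ℂ] defectSpace (adjoint c)),
        (∀ k, τ (Z k) = (Z₁ (σ k).1, Z₂ (σ k).2)) →
        IsTransfer t Z R θ → IsTransfer s Z₁ R₁ θ₁ → IsTransfer c Z₂ R₂ θ₂ →
        ∀ p, Ws (θ p) = diagOne θ₂ Q (U (diagOne θ₁ P (W p))) := by
  have hs := h.contraction_fst ht
  have hc := h.contraction_snd ht
  refine Exists.elim (exists_corner_factorization hs hc (h.norm_sq_le ht)) fun L hLx => ?_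
  have hL := hLx.1
  have hx := hLx.2
  refine Exists.elim (exists_adjoint_restrict hs) fun ρ hρ => ?_
  refine Exists.elim (exists_restrict hc) fun κ hκ => ?_
  refine Exists.elim (exists_juliaUnitary hL) fun U hU => ?_
  refine Exists.elim (h.exists_unitary_defectSpace ht hL hx hρ) fun W hW => ?_
  refine Exists.elim (h.exists_unitary_defectSpace_adjoint ht hL hx hκ) fun Ws hWs => ?_
  refine ⟨defectSpace L, inferInstance, inferInstance, inferInstance, defectSpace (adjoint L),
    inferInstance, inferInstance, inferInstance, U, W, Ws, fun Z Z₁ Z₂ R R₁ R₂ θ θ₁ θ₂ hZ hθ hθ₁ hθ₂ p => ?_⟩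
  refine factorization_of_dense hL hU W Ws (denseRange_defectMap t) (fun k => ?_) p
  have e1 := (h.state_equations hZ hθ hθ₁ hθ₂ k rfl).1
  have e2 := (h.state_equations hZ hθ hθ₁ hθ₂ k rfl).2
  rw [hx] at e1
  rw [adjoint_corner_eq hx] at e2
  -- The signals are `q = D_c k₂` and `m = D_{s*} v₁`, where `v = R (Z - t) k`; `p` and `r` are the
  -- first components of the two block defect vectors.
  exact ⟨_, defectMap c (σ k).2, defectMap (adjoint s) (τ (R (Z k - t k))).1, _, hW k,
    (congrArg Ws (hθ.apply_defectMap k)).trans (hWs _),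
    hθ₁.apply_defectMap_sub hρ _ _ e1, hθ₂.apply_add_defectMap hκ _ _ e2⟩

end IsBlock

end BlockTriangular

set_option maxHeartbeats 1000000

/-! ### Block triangular row contractions -/

section TwoBlocks

universe u₁ u₂

variable {n : ℕ} {G : Type*} {A : Type u₁} {B : Type u₂}
  [NormedAddCommGroup G] [InnerProductSpace ℂ G] [CompleteSpace G]
  [NormedAddCommGroup A] [InnerProductSpace ℂ A] [CompleteSpace A]
  [NormedAddCommGroup B] [InnerProductSpace ℂ B] [CompleteSpace B]

/-- The row operator `Bⁿ → A` of a tuple of operators `B → A`. -/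
noncomputable def rowTo (X : Fin n → B →L[ℂ] A) : PiLp 2 (fun _ : Fin n => B) →L[ℂ] A :=
  ∑ i, X i ∘L PiLp.proj 2 (fun _ : Fin n => B) i

lemma rowTo_apply (X : Fin n → B →L[ℂ] A) (x : PiLp 2 fun _ : Fin n => B) :
    rowTo X x = ∑ i, X i (x i) := by
  simp [rowTo]

/-- The linear isomorphism `Gⁿ ≃ Aⁿ × Bⁿ` induced by `G ≃ A × B`. -/
noncomputable def splitRow (n : ℕ) {G A B : Type*}
    [NormedAddCommGroup G] [InnerProductSpace ℂ G]
    [NormedAddCommGroup A] [InnerProductSpace ℂ A] [NormedAddCommGroup B] [InnerProductSpace ℂ B]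
    (τ : G ≃ₗ[ℂ] A × B) :
    PiLp 2 (fun _ : Fin n => G) ≃ₗ[ℂ]
      PiLp 2 (fun _ : Fin n => A) × PiLp 2 (fun _ : Fin n => B) where
  toFun x := (WithLp.toLp 2 fun i => (τ (x i)).1, WithLp.toLp 2 fun i => (τ (x i)).2)
  invFun y := WithLp.toLp 2 fun i => τ.symm (y.1 i, y.2 i)
  map_add' x y := by
    refine Prod.ext ?_ ?_ <;> ext i <;> simp
  map_smul' c x := by
    refine Prod.ext ?_ ?_ <;> ext i <;> simp
  left_inv x := by ext i; simp
  right_inv y := by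
    refine Prod.ext ?_ ?_ <;> ext i <;> simp

@[simp]
lemma splitRow_fst_apply (τ : G ≃ₗ[ℂ] A × B) (x : PiLp 2 fun _ : Fin n => G) (i : Fin n) :
    (splitRow n τ x).1 i = (τ (x i)).1 := rfl

@[simp]
lemma splitRow_snd_apply (τ : G ≃ₗ[ℂ] A × B) (x : PiLp 2 fun _ : Fin n => G) (i : Fin n) :
    (splitRow n τ x).2 i = (τ (x i)).2 := rfl

lemma IsOrthogonalSum.splitRow {τ : G ≃ₗ[ℂ] A × B} (h : IsOrthogonalSum τ) :
    IsOrthogonalSum (splitRow n τ) := fun x y => by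
  simp [PiLp.inner_apply, h (x _) (y _), Finset.sum_add_distrib]

/-- `Tᵢ = [[Sᵢ, Xᵢ], [0, Cᵢ]]` with respect to `G = A ⊕ B`. -/
def IsBlockTriangular (τ : G ≃ₗ[ℂ] A × B) (T : Fin n → G →L[ℂ] G)
    (S : Fin n → A →L[ℂ] A) (X : Fin n → B →L[ℂ] A) (C : Fin n → B →L[ℂ] B) : Prop :=
  IsOrthogonalSum τ ∧ ∀ i y, τ (T i y) = (S i (τ y).1 + X i (τ y).2, C i (τ y).2)

variable {τ : G ≃ₗ[ℂ] A × B} {T : Fin n → G →L[ℂ] G}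
  {S : Fin n → A →L[ℂ] A} {X : Fin n → B →L[ℂ] A} {C : Fin n → B →L[ℂ] B}

namespace IsBlockTriangular

lemma isBlock_row (h : IsBlockTriangular τ T S X C) :
    IsBlock (splitRow n τ) τ (row T) (row S) (rowTo X) (row C) := by
  refine ⟨h.1.splitRow, h.1, fun x => ?_⟩
  refine Prod.ext ?_ ?_ <;>
  simp [DruryArveson.row_apply, rowTo_apply, h.2, Finset.sum_add_distrib, Prod.fst_sum,
    Prod.snd_sum]

lemma zRow_apply (z : EuclideanSpace ℂ (Fin n)) (x : PiLp 2 fun _ : Fin n => G) :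
    τ (zRow G z x) = (zRow A z (splitRow n τ x).1, zRow B z (splitRow n τ x).2) := by
  refine Prod.ext ?_ ?_ <;>
  simp [zRow, DruryArveson.row_apply, Prod.fst_sum, Prod.snd_sum]

lemma fst_isCommutingRowContraction (h : IsBlockTriangular τ T S X C)
    (hT : IsCommutingRowContraction T) : IsCommutingRowContraction S := by
  refine ⟨fun i j => ?_, h.isBlock_row.contraction_fst hT.contraction⟩
  ext1 a
  have := congrArg (fun R : G →L[ℂ] G => (τ (R (τ.symm (a, 0)))).1) (hT.commute i j)
  simpa [h.2] using this

lemma snd_isCommutingRowContraction (h : IsBlockTriangular τ T S X C)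
    (hT : IsCommutingRowContraction T) : IsCommutingRowContraction C := by
  refine ⟨fun i j => ?_, h.isBlock_row.contraction_snd hT.contraction⟩
  ext1 b
  have := congrArg (fun R : G →L[ℂ] G => (τ (R (τ.symm (0, b)))).2) (hT.commute i j)
  simpa [h.2] using this

/-- The characteristic function of a block triangular row contraction factors into those of its
diagonal entries. -/
theorem exists_charFun_factorization (h : IsBlockTriangular τ T S X C) (hT : ‖row T‖ ≤ 1) :
    ∃ (P : Type u₂) (_ : NormedAddCommGroup P) (_ : InnerProductSpace ℂ P) (_ : CompleteSpace P)
      (Q : Type u₁) (_ : NormedAddCommGroup Q) (_ : InnerProductSpace ℂ Q) (_ : CompleteSpace Q)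
      (U : WithLp 2 (defectSpace (adjoint (row S)) × P) ≃ₗᵢ[ℂ]
        WithLp 2 (defectSpace (row C) × Q))
      (W : defectSpace (row T) ≃ₗᵢ[ℂ] WithLp 2 (defectSpace (row S) × P))
      (Ws : defectSpace (adjoint (row T)) ≃ₗᵢ[ℂ]
        WithLp 2 (defectSpace (adjoint (row C)) × Q)),
      ∀ z ∈ Metric.ball (0 : EuclideanSpace ℂ (Fin n)) 1, ∀ x,
        Ws (charFun T z x) = diagOne (charFun C z) Q (U (diagOne (charFun S z) P (W x))) :=
  (h.isBlock_row.exists_transfer_factorization hT).imp fun _ => Exists.imp fun _ =>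
    Exists.imp fun _ => Exists.imp fun _ => Exists.imp fun _ => Exists.imp fun _ =>
    Exists.imp fun _ => Exists.imp fun _ => Exists.imp fun _ => Exists.imp fun _ =>
    Exists.imp fun _ hf z hz =>
      hf _ _ _ _ _ _ _ _ _ (zRow_apply z) (isTransfer_charFun hT hz)
        (isTransfer_charFun (h.isBlock_row.contraction_fst hT) hz)
        (isTransfer_charFun (h.isBlock_row.contraction_snd hT) hz)

end IsBlockTriangular

end TwoBlocks

/-! ### Composing two factorizations and passing to operators -/

section Cascade

variable {n : ℕ} {A B B' K D D' : Type*}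
  [NormedAddCommGroup A] [InnerProductSpace ℂ A]
  [NormedAddCommGroup B] [InnerProductSpace ℂ B]
  [NormedAddCommGroup B'] [InnerProductSpace ℂ B']
  [NormedAddCommGroup K] [InnerProductSpace ℂ K]
  [NormedAddCommGroup D] [InnerProductSpace ℂ D]
  [NormedAddCommGroup D'] [InnerProductSpace ℂ D']

/-- The unitary `A ⊕ K → B ⊕ (B' ⊕ K)` induced by a unitary `A → B ⊕ B'`. -/
noncomputable def assocCongr (f : A ≃ₗᵢ[ℂ] WithLp 2 (B × B')) (K : Type*) [NormedAddCommGroup K]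
    [InnerProductSpace ℂ K] : WithLp 2 (A × K) ≃ₗᵢ[ℂ] WithLp 2 (B × WithLp 2 (B' × K)) :=
  (LinearIsometryEquiv.withLpProdCongr 2 f (LinearIsometryEquiv.refl ℂ K)).trans
    (LinearIsometryEquiv.withLpProdAssoc 2 ℂ B B' K)

lemma assocCongr_apply (f : A ≃ₗᵢ[ℂ] WithLp 2 (B × B')) (x : WithLp 2 (A × K)) :
    assocCongr f K x = WithLp.toLp 2 ((f x.fst).fst, WithLp.toLp 2 ((f x.fst).snd, x.snd)) := rfl

lemma diagOne_assocCongr (f : A ≃ₗᵢ[ℂ] WithLp 2 (B × B')) (φ : B →L[ℂ] D) (x : WithLp 2 (A × K)) :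
    diagOne φ (WithLp 2 (B' × K)) (assocCongr f K x) =
      assocCongr (LinearIsometryEquiv.refl ℂ (WithLp 2 (D × B'))) K
        (diagOne (diagOne φ B' ∘L (f : A →L[ℂ] WithLp 2 (B × B'))) K x) := by
  simp only [diagOne_apply, assocCongr_apply, ContinuousLinearMap.comp_apply]
  rfl

lemma assocCongr_diagOne (g : D ≃ₗᵢ[ℂ] WithLp 2 (B × B')) (φ : A →L[ℂ] D) (x : WithLp 2 (A × K)) :
    assocCongr g K (diagOne φ K x) =
      assocCongr (LinearIsometryEquiv.refl ℂ (WithLp 2 (B × B'))) K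
        (diagOne ((g : D →L[ℂ] WithLp 2 (B × B')) ∘L φ) K x) := by
  simp only [diagOne_apply, assocCongr_apply, ContinuousLinearMap.comp_apply]
  rfl

variable {P P' Q Q' DT DT' DS DS' DR DR' DN DN' DC DC' : Type*}
  [NormedAddCommGroup P] [InnerProductSpace ℂ P] [NormedAddCommGroup P'] [InnerProductSpace ℂ P']
  [NormedAddCommGroup Q] [InnerProductSpace ℂ Q] [NormedAddCommGroup Q'] [InnerProductSpace ℂ Q']
  [NormedAddCommGroup DT] [InnerProductSpace ℂ DT] [NormedAddCommGroup DT'] [InnerProductSpace ℂ DT']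
  [NormedAddCommGroup DS] [InnerProductSpace ℂ DS] [NormedAddCommGroup DS'] [InnerProductSpace ℂ DS']
  [NormedAddCommGroup DR] [InnerProductSpace ℂ DR] [NormedAddCommGroup DR'] [InnerProductSpace ℂ DR']
  [NormedAddCommGroup DN] [InnerProductSpace ℂ DN] [NormedAddCommGroup DN'] [InnerProductSpace ℂ DN']
  [NormedAddCommGroup DC] [InnerProductSpace ℂ DC] [NormedAddCommGroup DC'] [InnerProductSpace ℂ DC']

/-- Substituting a factorization of `θR` into a factorization of `θT` through `θR`. -/
lemma factorization_trans
    {U : WithLp 2 (DS' × P) ≃ₗᵢ[ℂ] WithLp 2 (DR × Q)}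
    {W : DT ≃ₗᵢ[ℂ] WithLp 2 (DS × P)} {Ws : DT' ≃ₗᵢ[ℂ] WithLp 2 (DR' × Q)}
    {U' : WithLp 2 (DN' × P') ≃ₗᵢ[ℂ] WithLp 2 (DC × Q')}
    {W' : DR ≃ₗᵢ[ℂ] WithLp 2 (DN × P')} {Ws' : DR' ≃ₗᵢ[ℂ] WithLp 2 (DC' × Q')}
    {θT : DT →L[ℂ] DT'} {θS : DS →L[ℂ] DS'} {θR : DR →L[ℂ] DR'} {θN : DN →L[ℂ] DN'}
    {θC : DC →L[ℂ] DC'}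
    (h : ∀ x, Ws (θT x) = diagOne θR Q (U (diagOne θS P (W x))))
    (h' : ∀ x, Ws' (θR x) = diagOne θC Q' (U' (diagOne θN P' (W' x)))) (x : DT) :
    (Ws.trans (assocCongr Ws' Q)) (θT x) =
      diagOne θC (WithLp 2 (Q' × Q))
        (((assocCongr (LinearIsometryEquiv.refl ℂ (WithLp 2 (DN' × P'))) Q).symm.trans
            (assocCongr U' Q))
          (diagOne θN (WithLp 2 (P' × Q)) ((U.trans (assocCongr W' Q)) (diagOne θS P (W x))))) := by
  simp only [LinearIsometryEquiv.trans_apply]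
  -- The unused summand `Q` is carried along unchanged, so both sides become the two factorizations
  -- of `θR x` with an extra identity block.
  rw [h, diagOne_assocCongr W' θN, LinearIsometryEquiv.symm_apply_apply, diagOne_assocCongr U' θC,
    assocCongr_diagOne]
  congr 1
  simp only [diagOne_apply]
  congr 2
  exact h' _

/-- A pointwise factorization of a multiplier yields a factorization of multiplication
operators. -/
lemma coincides_of_factorization [CompleteSpace P] [CompleteSpace P'] [CompleteSpace Q]
    [CompleteSpace DT] [CompleteSpace DT'] [CompleteSpace DS] [CompleteSpace DS']
    [CompleteSpace DN] [CompleteSpace DN'] [CompleteSpace DC] [CompleteSpace DC']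
    {U₁ : WithLp 2 (DN' × P') ≃ₗᵢ[ℂ] WithLp 2 (DC × Q)}
    {U₂ : WithLp 2 (DS' × P) ≃ₗᵢ[ℂ] WithLp 2 (DN × P')}
    {W : DT ≃ₗᵢ[ℂ] WithLp 2 (DS × P)} {Ws : DT' ≃ₗᵢ[ℂ] WithLp 2 (DC' × Q)}
    {θT : EuclideanSpace ℂ (Fin n) → DT →L[ℂ] DT'} {θS : EuclideanSpace ℂ (Fin n) → DS →L[ℂ] DS'}
    {θN : EuclideanSpace ℂ (Fin n) → DN →L[ℂ] DN'} {θC : EuclideanSpace ℂ (Fin n) → DC →L[ℂ] DC'}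
    {MT : Space n DT →L[ℂ] Space n DT'} {MS : Space n DS →L[ℂ] Space n DS'}
    {MN : Space n DN →L[ℂ] Space n DN'} {MC : Space n DC →L[ℂ] Space n DC'}
    (hT : IsMulOp θT MT) (hS : IsMulOp θS MS) (hN : IsMulOp θN MN) (hC : IsMulOp θC MC)
    (h : ∀ z ∈ Metric.ball (0 : EuclideanSpace ℂ (Fin n)) 1, ∀ x, Ws (θT z x) =
      diagOne (θC z) Q (U₁ (diagOne (θN z) P' (U₂ (diagOne (θS z) P (W x)))))) :
    Coincides MT
      (diagId MC Q ∘L ampl n (U₁ : WithLp 2 (DN' × P') →L[ℂ] WithLp 2 (DC × Q)) ∘L diagId MN P' ∘L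
        ampl n (U₂ : WithLp 2 (DS' × P) →L[ℂ] WithLp 2 (DN × P')) ∘L diagId MS P) := by
  refine ⟨W, Ws, IsMulOp.unique (((isMulOp_ampl _).comp hT).congr fun z hz => ?_)
    ((hC.diagId.comp ((isMulOp_ampl _).comp (hN.diagId.comp ((isMulOp_ampl _).comp
      hS.diagId)))).comp (isMulOp_ampl _))⟩
  ext1 x
  exact h z hz x

end Cascade

/-! ### Partial isometries obtained from diagonal blocks -/

section PartialIsometries

variable {n : ℕ} {E F G K : Type*}
  [NormedAddCommGroup E] [InnerProductSpace ℂ E] [CompleteSpace E]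
  [NormedAddCommGroup F] [InnerProductSpace ℂ F] [CompleteSpace F]
  [NormedAddCommGroup G] [InnerProductSpace ℂ G] [CompleteSpace G]
  [NormedAddCommGroup K] [InnerProductSpace ℂ K] [CompleteSpace K]

/-- For `x` orthogonal to the kernel, `x - V* V x` lies in the kernel, hence is orthogonal both to
`x` and to the range of `V*`. So it vanishes. -/
lemma isPartialIsometry_of_comp_adjoint_comp {V : E →L[ℂ] F} (h : ∀ x, V (adjoint V (V x)) = V x) :
    IsPartialIsometry V := by
  intro x hx
  have h1 : x - adjoint V (V x) ∈ LinearMap.ker (V : E →ₗ[ℂ] F) := by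
    simp [h]
  have h2 : inner ℂ (x - adjoint V (V x)) (adjoint V (V x)) = 0 := by
    rw [adjoint_inner_right]
    have : V (x - adjoint V (V x)) = 0 := h1
    rw [this, inner_zero_left]
  have h3 : inner ℂ (x - adjoint V (V x)) x = 0 := (Submodule.mem_orthogonal _ _).1 hx _ h1
  have h4 : x - adjoint V (V x) = 0 := by
    rw [← inner_self_eq_zero (𝕜 := ℂ), inner_sub_right, h2, h3, sub_zero]
  rw [← sq_eq_sq₀ (norm_nonneg _) (norm_nonneg _), ← inner_self_eq_norm_sq (𝕜 := ℂ) x,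
    ← inner_self_eq_norm_sq (𝕜 := ℂ) (V x), ← adjoint_inner_left, ← sub_eq_zero.1 h4]

lemma ampl_apply (A : E →L[ℂ] F) (f : Space n E) (α : Fin n → ℕ) : ampl n A f α = A (f α) := rfl

lemma ampl_comp (A : F →L[ℂ] G) (B : E →L[ℂ] F) : ampl n (A ∘L B) = ampl n A ∘L ampl n B := rfl

lemma ampl_id : ampl n (ContinuousLinearMap.id ℂ E) = ContinuousLinearMap.id ℂ (Space n E) := rfl

lemma adjoint_ampl (A : E →L[ℂ] F) : adjoint (ampl n A) = ampl n (adjoint A) := by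
  refine ContinuousLinearMap.ext fun f => ext_inner_right ℂ fun g => ?_
  rw [adjoint_inner_left, lp.inner_eq_tsum, lp.inner_eq_tsum]
  simp only [ampl_apply, adjoint_inner_left]

lemma isCoisometry_ampl {A : E →L[ℂ] F} (h : IsCoisometry A) : IsCoisometry (ampl n A) := by
  rw [IsCoisometry] at h ⊢
  rw [adjoint_ampl, ← ampl_comp, h, ampl_id]

lemma isPartialIsometry_ampl {A : E →L[ℂ] F} (h : ∀ x, A (adjoint A (A x)) = A x) :
    IsPartialIsometry (ampl n A) := by
  refine isPartialIsometry_of_comp_adjoint_comp fun f => ?_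
  rw [adjoint_ampl]
  ext α
  exact h _

lemma adjoint_diagOne (A : E →L[ℂ] F) : adjoint (diagOne A K) = diagOne (adjoint A) K := by
  refine ContinuousLinearMap.ext fun x => ext_inner_right ℂ fun y => ?_
  rw [adjoint_inner_left]
  simp [WithLp.prod_inner_apply, adjoint_inner_left]

lemma diagId_zero : diagId (0 : Space n E →L[ℂ] Space n F) K =
    ampl n (diagOne (0 : E →L[ℂ] F) K) := by
  refine ContinuousLinearMap.ext fun f => ?_
  ext α
  simp only [ampl_apply, diagOne_apply]
  simp [diagId, ampl_apply, inrL]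

lemma comp_isometry_diagOne_zero {D D' : Type*}
    [NormedAddCommGroup D] [InnerProductSpace ℂ D] [CompleteSpace D]
    [NormedAddCommGroup D'] [InnerProductSpace ℂ D'] [CompleteSpace D']
    (V : WithLp 2 (F × K) ≃ₗᵢ[ℂ] D') (W : D ≃ₗᵢ[ℂ] WithLp 2 (E × K)) (x : D) :
    let A : D →L[ℂ] D' := (V : WithLp 2 (F × K) →L[ℂ] D') ∘L diagOne (0 : E →L[ℂ] F) K ∘L
      (W : D →L[ℂ] WithLp 2 (E × K))
    A (adjoint A (A x)) = A x := by
  intro A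
  simp [A, adjoint_comp, adjoint_diagOne, LinearIsometryEquiv.adjoint_eq_symm]

lemma isCoisometry_diagOne_zero {D D' : Type*}
    [NormedAddCommGroup D] [InnerProductSpace ℂ D] [CompleteSpace D]
    [NormedAddCommGroup D'] [InnerProductSpace ℂ D'] [CompleteSpace D'] [Subsingleton F]
    (V : WithLp 2 (F × K) ≃ₗᵢ[ℂ] D') (W : D ≃ₗᵢ[ℂ] WithLp 2 (E × K)) :
    IsCoisometry ((V : WithLp 2 (F × K) →L[ℂ] D') ∘L diagOne (0 : E →L[ℂ] F) K ∘L
      (W : D →L[ℂ] WithLp 2 (E × K))) := by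
  refine ContinuousLinearMap.ext fun y => ?_
  simp [adjoint_comp, adjoint_diagOne, LinearIsometryEquiv.adjoint_eq_symm]
  rw [show WithLp.toLp 2 ((0 : F), (V.symm y).snd) = V.symm y from
    WithLp.ofLp_injective 2 (Prod.ext (Subsingleton.elim (α := F) _ _) rfl),
    LinearIsometryEquiv.apply_symm_apply]

end PartialIsometries

/-! ### Vanishing of the outer blocks -/

section Purity

variable {n : ℕ} {H : Type*} [NormedAddCommGroup H] [InnerProductSpace ℂ H] [CompleteSpace H]

lemma isMulOp_zero {E F : Type*} [NormedAddCommGroup E] [InnerProductSpace ℂ E] [CompleteSpace E]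
    [NormedAddCommGroup F] [InnerProductSpace ℂ F] [CompleteSpace F] :
    IsMulOp (fun _ => 0) (0 : Space n E →L[ℂ] Space n F) := fun f z hz => by
  have := eval_smul 0 (0 : Space n F) hz
  rw [zero_smul, zero_smul] at this
  simpa using this

lemma charOp_eq_zero {T : Fin n → H →L[ℂ] H} (hT : ‖row T‖ ≤ 1)
    (h : ∀ z ∈ Metric.ball (0 : EuclideanSpace ℂ (Fin n)) 1, charFun T z = 0) : charOp T = 0 :=
  (isMulOp_mulOp (isMultiplier_charFun hT)).unique
    (isMulOp_zero.congr fun z hz => (h z hz).symm)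

lemma row_comp_adjoint_row (T : Fin n → H →L[ℂ] H) :
    row T ∘L adjoint (row T) = ∑ i, T i ∘L adjoint (T i) := by
  ext1 h
  simp [row_apply, adjoint_row_apply]

lemma IsSphericalCoisometry.subsingleton_defectSpace {C : Fin n → H →L[ℂ] H}
    (h : IsSphericalCoisometry C) : Subsingleton (defectSpace (adjoint (row C))) := by
  have h0 : defectOp (adjoint (row C)) = 0 := by
    rw [defectOp, adjoint_adjoint, row_comp_adjoint_row, h]
    exact (congrArg CFC.sqrt (sub_self _)).trans CFC.sqrt_zero
  have hb : defectSpace (adjoint (row C)) = ⊥ := by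
    rw [defectSpace, h0]
    simp
  rw [hb]
  infer_instance

end Purity

section Shift

variable {n : ℕ} {H E : Type*} [NormedAddCommGroup H] [InnerProductSpace ℂ H] [CompleteSpace H]
  [NormedAddCommGroup E] [InnerProductSpace ℂ E] [CompleteSpace E]
  {S : Fin n → H →L[ℂ] H} {U : H ≃ₗᵢ[ℂ] Space n E}

/-- The unitary `U` intertwines each `Sᵢ` with multiplication by the coordinate `zᵢ`. -/
def IsShiftModel (S : Fin n → H →L[ℂ] H) (U : H ≃ₗᵢ[ℂ] Space n E) : Prop :=
  ∀ i, ∀ h, ∀ z ∈ Metric.ball (0 : EuclideanSpace ℂ (Fin n)) 1,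
    eval (U (S i h)) z = z i • eval (U h) z

namespace IsShiftModel

/-- The pull-back of the kernel vector `k_w ⊗ η`. -/
noncomputable def ker (U : H ≃ₗᵢ[ℂ] Space n E)
    (w : Metric.ball (0 : EuclideanSpace ℂ (Fin n)) 1) (η : E) : H := U.symm (kern w η)

lemma inner_ker (w : Metric.ball (0 : EuclideanSpace ℂ (Fin n)) 1) (η : E) (h : H) :
    inner ℂ (ker U w η) h = inner ℂ η (eval (U h) w) := by
  rw [← inner_kern_left, ← U.inner_map_map, ker, U.apply_symm_apply]

lemma ext_ker {h k : H} (hk : ∀ w η, inner ℂ (ker U w η) h = inner ℂ (ker U w η) k) : h = k := by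
  refine U.injective (ext_eval fun z hz => ext_inner_left ℂ fun η => ?_)
  simpa only [inner_ker] using hk ⟨z, hz⟩ η

/-- The backward shift has kernel vectors as joint eigenvectors; consequently `S*` and `Z_w*` agree
on `k_w ⊗ η`. -/
lemma adjoint_ker (hS : IsShiftModel S U) (i : Fin n)
    (w : Metric.ball (0 : EuclideanSpace ℂ (Fin n)) 1) (η : E) :
    adjoint (S i) (ker U w η) = star (w.1 i) • ker U w η := by
  refine ext_inner_right ℂ fun h => ?_
  rw [adjoint_inner_left, inner_ker, hS _ _ _ w.2, inner_smul_left, inner_smul_right, inner_ker]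
  simp

lemma adjoint_row_ker (hS : IsShiftModel S U)
    (w : Metric.ball (0 : EuclideanSpace ℂ (Fin n)) 1) (η : E) :
    adjoint (row S) (ker U w η) = adjoint (zRow H w.1) (ker U w η) := by
  rw [adjoint_row_apply, adjoint_zRow_apply]
  simp [hS.adjoint_ker]

/-- The origin of the ball. -/
def origin : Metric.ball (0 : EuclideanSpace ℂ (Fin n)) 1 := ⟨0, by simp⟩

/-- `I - S S*` is the projection onto the constants, and `k_0 ⊗ η` is the constant `η`. -/
lemma row_adjoint_row_ker (hS : IsShiftModel S U)
    (w : Metric.ball (0 : EuclideanSpace ℂ (Fin n)) 1) (η : E) :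
    ker U w η - row S (adjoint (row S) (ker U w η)) = ker U origin η := by
  refine ext_ker (U := U) fun z ξ => ?_
  have hne : 1 - ∑ i, z.1 i * star (w.1 i) ≠ 0 := by
    intro h0
    have h1 := sum_norm_mul_lt_one (mem_ball_zero_iff.1 w.2) (mem_ball_zero_iff.1 z.2)
    have h2 := norm_sum_le Finset.univ fun i => z.1 i * star (w.1 i)
    rw [← sub_eq_zero.1 h0, norm_one] at h2
    linarith
  rw [inner_sub_right, ← adjoint_inner_left, hS.adjoint_row_ker, hS.adjoint_row_ker,
    adjoint_inner_left, zRow_adjoint_zRow, inner_smul_right, inner_ker, inner_ker, ker, ker,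
    U.apply_symm_apply, U.apply_symm_apply, eval_kern, eval_kern, inner_smul_right,
    inner_smul_right]
  simp only [origin]
  field_simp
  simp

/-- For `v = (I - Z S*)⁻¹ (Z - S) x`, pair `(I - Z S*) v = (Z - S) x` with `k_z ⊗ η`. As `S*` and
`Z*` agree there, the right side gives `0` and the left side `⟨k_0 ⊗ η, v⟩`. Thus `v` vanishes at
the origin, so `(I - S S*) v = 0`. -/
lemma defectOp_adjoint_row_eq_zero (hS : IsShiftModel S U) (hc : ‖row S‖ ≤ 1)
    (z : Metric.ball (0 : EuclideanSpace ℂ (Fin n)) 1) (x : PiLp 2 fun _ : Fin n => H) :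
    defectOp (adjoint (row S)) (Ring.inverse (1 - zStar S z) (zRow H z.1 x - row S x)) = 0 := by
  have hc' : ‖adjoint (row S)‖ ≤ 1 := by simpa using hc
  have h3 := one_sub_zStar_inverse hc z.2 (zRow H z.1 x - row S x)
  generalize Ring.inverse (1 - zStar S z) (zRow H z.1 x - row S x) = v at h3 ⊢
  have h1 : ∀ w η, inner ℂ (ker U w η) (v - row S (adjoint (row S) v)) =
      inner ℂ (ker U origin η) v := fun w η => by
    rw [← hS.row_adjoint_row_ker w, inner_sub_right, inner_sub_left,
      ← adjoint_inner_left (row S), ← adjoint_inner_right (row S)]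
  have h2 : ∀ η, inner ℂ (ker U origin η) v = 0 := fun η => by
    have h4 := congrArg (inner ℂ (ker U z η)) h3
    rw [inner_sub_right, inner_sub_right, ← adjoint_inner_left (zRow H z.1),
      ← adjoint_inner_left (zRow H z.1), ← adjoint_inner_left (row S), ← hS.adjoint_row_ker,
      sub_self, adjoint_inner_right, ← inner_sub_left, hS.row_adjoint_row_ker] at h4
    exact h4
  have h5 : v - row S (adjoint (row S) v) = 0 :=
    ext_ker (U := U) fun w η => by rw [h1, h2, inner_zero_right]
  have h4 := defectOp_sq hc' v
  rw [adjoint_adjoint, h5] at h4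
  rw [← inner_self_eq_zero (𝕜 := ℂ), inner_defectOp_left, h4, inner_zero_right]

lemma charFun_eq_zero (hS : IsShiftModel S U) (hc : ‖row S‖ ≤ 1) {z : EuclideanSpace ℂ (Fin n)}
    (hz : z ∈ Metric.ball (0 : EuclideanSpace ℂ (Fin n)) 1) : charFun S z = 0 := by
  refine ContinuousLinearMap.ext fun p => ?_
  refine (denseRange_defectMap (row S)).induction_on (p := fun p => charFun S z p = 0) p
    (isClosed_eq (charFun S z).continuous continuous_const) fun x => ?_
  rw [(isTransfer_charFun hc hz).apply_defectMap]
  exact Subtype.ext (hS.defectOp_adjoint_row_eq_zero hc ⟨z, hz⟩ x)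

end IsShiftModel

lemma IsShift.charOp_eq_zero {H : Type u} [NormedAddCommGroup H] [InnerProductSpace ℂ H]
    [CompleteSpace H] {S : Fin n → H →L[ℂ] H} (h : IsShift S) (hc : ‖row S‖ ≤ 1) :
    charOp S = 0 := by
  obtain ⟨W, _, _, _, U, hU⟩ := h
  have hS : IsShiftModel S U := fun i h z hz => by
    simpa using hU i (U h) z hz
  exact DruryArveson.charOp_eq_zero hc fun z hz => hS.charFun_eq_zero hc hz

end Shift

/-! ### Three blocks and the main theorem -/

section MainTheorem

lemma Coincides.exists_partialIsometries {n : ℕ} {DT DT' DS DS' DN DN' DC DC' E₁ E₂ E : Type*}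
    [NormedAddCommGroup DT] [InnerProductSpace ℂ DT] [CompleteSpace DT]
    [NormedAddCommGroup DT'] [InnerProductSpace ℂ DT'] [CompleteSpace DT']
    [NormedAddCommGroup DS] [InnerProductSpace ℂ DS] [CompleteSpace DS]
    [NormedAddCommGroup DS'] [InnerProductSpace ℂ DS'] [CompleteSpace DS']
    [NormedAddCommGroup DN] [InnerProductSpace ℂ DN] [CompleteSpace DN]
    [NormedAddCommGroup DN'] [InnerProductSpace ℂ DN'] [CompleteSpace DN']
    [NormedAddCommGroup DC] [InnerProductSpace ℂ DC] [CompleteSpace DC]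
    [NormedAddCommGroup DC'] [InnerProductSpace ℂ DC'] [CompleteSpace DC'] [Subsingleton DC']
    [NormedAddCommGroup E₁] [InnerProductSpace ℂ E₁] [CompleteSpace E₁]
    [NormedAddCommGroup E₂] [InnerProductSpace ℂ E₂] [CompleteSpace E₂]
    [NormedAddCommGroup E] [InnerProductSpace ℂ E] [CompleteSpace E]
    {MT : Space n DT →L[ℂ] Space n DT'} {MS : Space n DS →L[ℂ] Space n DS'}
    {MN : Space n DN →L[ℂ] Space n DN'} {MC : Space n DC →L[ℂ] Space n DC'}
    {U₁ : WithLp 2 (DN' × E) ≃ₗᵢ[ℂ] WithLp 2 (DC × E₁)}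
    {U₂ : WithLp 2 (DS' × E₂) ≃ₗᵢ[ℂ] WithLp 2 (DN × E)}
    (h : Coincides MT
      (diagId MC E₁ ∘L ampl n (U₁ : WithLp 2 (DN' × E) →L[ℂ] WithLp 2 (DC × E₁)) ∘L diagId MN E ∘L
        ampl n (U₂ : WithLp 2 (DS' × E₂) →L[ℂ] WithLp 2 (DN × E)) ∘L diagId MS E₂))
    (hS : MS = 0) :
    ∃ (G₁ : Space n (WithLp 2 (DN' × E)) →L[ℂ] Space n DT')
      (G₂ : Space n DT →L[ℂ] Space n (WithLp 2 (DN × E))),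
      IsCoisometry G₁ ∧ IsPartialIsometry G₂ ∧ MT = G₁ ∘L diagId MN E ∘L G₂ := by
  obtain ⟨W, Ws, hW⟩ := h
  have hC : MC = 0 := by
    ext f α
    exact Subsingleton.elim (α := DC') _ _
  -- Here `G₁ = I ⊗ (W_*⁻¹ diag(0, I) U₁)` and `G₂ = I ⊗ (U₂ diag(0, I) W)`.
  refine ⟨_, _, isCoisometry_ampl (isCoisometry_diagOne_zero Ws.symm U₁),
    isPartialIsometry_ampl (comp_isometry_diagOne_zero U₂ W), ?_⟩
  rw [hS, hC, diagId_zero, diagId_zero] at hW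
  have h1 : ampl n (Ws.symm : WithLp 2 (DC' × E₁) →L[ℂ] DT') ∘L
      ampl n (Ws : DT' →L[ℂ] WithLp 2 (DC' × E₁)) =
      ContinuousLinearMap.id ℂ (Space n DT') := by
    rw [← ampl_comp, ← ampl_id]
    congr 1
    ext x
    simp
  have h2 := congrArg (fun M => ampl n (Ws.symm : WithLp 2 (DC' × E₁) →L[ℂ] DT') ∘L M) hW
  simp only [← ContinuousLinearMap.comp_assoc, h1, ContinuousLinearMap.id_comp] at h2
  simp only [h2, ampl_comp, ContinuousLinearMap.comp_assoc]

variable {n : ℕ} {G R A B D : Type u}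
  [NormedAddCommGroup G] [InnerProductSpace ℂ G] [CompleteSpace G]
  [NormedAddCommGroup R] [InnerProductSpace ℂ R] [CompleteSpace R]
  [NormedAddCommGroup A] [InnerProductSpace ℂ A] [CompleteSpace A]
  [NormedAddCommGroup B] [InnerProductSpace ℂ B] [CompleteSpace B]
  [NormedAddCommGroup D] [InnerProductSpace ℂ D] [CompleteSpace D]
  {τ : G ≃ₗ[ℂ] A × R} {τ' : R ≃ₗ[ℂ] B × D} {T : Fin n → G →L[ℂ] G}
  {S : Fin n → A →L[ℂ] A} {X : Fin n → R →L[ℂ] A} {Q : Fin n → R →L[ℂ] R}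
  {N : Fin n → B →L[ℂ] B} {Z : Fin n → D →L[ℂ] B} {C : Fin n → D →L[ℂ] D}

theorem IsBlockTriangular.exists_coincides (h : IsBlockTriangular τ T S X Q)
    (h' : IsBlockTriangular τ' Q N Z C) (hT : ‖row T‖ ≤ 1) :
    ∃ (E₁ : Type u) (_ : NormedAddCommGroup E₁) (_ : InnerProductSpace ℂ E₁)
        (_ : CompleteSpace E₁)
        (E₂ : Type u) (_ : NormedAddCommGroup E₂) (_ : InnerProductSpace ℂ E₂)
        (_ : CompleteSpace E₂)
        (E : Type u) (_ : NormedAddCommGroup E) (_ : InnerProductSpace ℂ E) (_ : CompleteSpace E)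
        (U₁ : WithLp 2 (defectSpace (adjoint (row N)) × E) ≃ₗᵢ[ℂ]
          WithLp 2 (defectSpace (row C) × E₁))
        (U₂ : WithLp 2 (defectSpace (adjoint (row S)) × E₂) ≃ₗᵢ[ℂ]
          WithLp 2 (defectSpace (row N) × E)),
      Coincides (charOp T)
        (diagId (charOp C) E₁ ∘L
          ampl n (U₁ : WithLp 2 (defectSpace (adjoint (row N)) × E) →L[ℂ]
            WithLp 2 (defectSpace (row C) × E₁)) ∘L
          diagId (charOp N) E ∘L
          ampl n (U₂ : WithLp 2 (defectSpace (adjoint (row S)) × E₂) →L[ℂ]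
            WithLp 2 (defectSpace (row N) × E)) ∘L
          diagId (charOp S) E₂) := by
  have hQ := h.isBlock_row.contraction_snd hT
  have hS := h.isBlock_row.contraction_fst hT
  have hN := h'.isBlock_row.contraction_fst hQ
  have hC := h'.isBlock_row.contraction_snd hQ
  refine (h.exists_charFun_factorization hT).elim fun P h₁ => h₁.elim fun _ h₁ =>
    h₁.elim fun _ h₁ => h₁.elim fun _ h₁ => h₁.elim fun K h₁ => h₁.elim fun _ h₁ =>
    h₁.elim fun _ h₁ => h₁.elim fun _ h₁ => h₁.elim fun U h₁ => h₁.elim fun W h₁ =>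
    h₁.elim fun Ws h₁ => ?_
  refine (h'.exists_charFun_factorization hQ).elim fun P' h₂ => h₂.elim fun _ h₂ =>
    h₂.elim fun _ h₂ => h₂.elim fun _ h₂ => h₂.elim fun K' h₂ => h₂.elim fun _ h₂ =>
    h₂.elim fun _ h₂ => h₂.elim fun _ h₂ => h₂.elim fun U' h₂ => h₂.elim fun W' h₂ =>
    h₂.elim fun Ws' h₂ => ?_
  exact ⟨WithLp 2 (K' × K), inferInstance, inferInstance, inferInstance, P, inferInstance,
    inferInstance, inferInstance, WithLp 2 (P' × K), inferInstance, inferInstance, inferInstance,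
    _, _, coincides_of_factorization (isMulOp_mulOp (isMultiplier_charFun hT))
      (isMulOp_mulOp (isMultiplier_charFun hS)) (isMulOp_mulOp (isMultiplier_charFun hN))
      (isMulOp_mulOp (isMultiplier_charFun hC)) fun z hz =>
        factorization_trans (h₁ z hz) (h₂ z hz)⟩

/-- `θ_T = G₁ (θ_N ⊕ I) G₂` for a co-isometry `G₁` and a partial isometry `G₂`. -/
def HasPartialIsometryFactorization {n : ℕ} {H K : Type u}
    [NormedAddCommGroup H] [InnerProductSpace ℂ H] [CompleteSpace H]
    [NormedAddCommGroup K] [InnerProductSpace ℂ K] [CompleteSpace K]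
    (T : Fin n → H →L[ℂ] H) (N : Fin n → K →L[ℂ] K) : Prop :=
  ∃ (E : Type u) (_ : NormedAddCommGroup E) (_ : InnerProductSpace ℂ E) (_ : CompleteSpace E)
    (G₁ : Space n (WithLp 2 (defectSpace (adjoint (row N)) × E)) →L[ℂ]
      Space n (defectSpace (adjoint (row T))))
    (G₂ : Space n (defectSpace (row T)) →L[ℂ] Space n (WithLp 2 (defectSpace (row N) × E))),
    IsCoisometry G₁ ∧ IsPartialIsometry G₂ ∧ charOp T = G₁ ∘L diagId (charOp N) E ∘L G₂

theorem IsBlockTriangular.hasPartialIsometryFactorization (h : IsBlockTriangular τ T S X Q)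
    (h' : IsBlockTriangular τ' Q N Z C) (hT : ‖row T‖ ≤ 1) (hS : charOp S = 0)
    [Subsingleton (defectSpace (adjoint (row C)))] : HasPartialIsometryFactorization T N :=
  (h.exists_coincides h' hT).elim fun _ h => h.elim fun _ h => h.elim fun _ h =>
    h.elim fun _ h => h.elim fun _ h => h.elim fun _ h => h.elim fun _ h => h.elim fun _ h =>
    h.elim fun E h => h.elim fun i₁ h => h.elim fun i₂ h => h.elim fun i₃ h =>
    h.elim fun _ h => h.elim fun _ h => ⟨E, i₁, i₂, i₃, h.exists_partialIsometries hS⟩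

set_option maxHeartbeats 1000000 in
/-- The operators of `HasPartialIsometryFactorization`, over the instances of a concrete direct
sum. -/
lemma HasPartialIsometryFactorization.exists_of_sum3 {n : ℕ} {H₁ H₀ Hm K : Type u}
    [NormedAddCommGroup H₁] [InnerProductSpace ℂ H₁] [CompleteSpace H₁]
    [NormedAddCommGroup H₀] [InnerProductSpace ℂ H₀] [CompleteSpace H₀]
    [NormedAddCommGroup Hm] [InnerProductSpace ℂ Hm] [CompleteSpace Hm]
    [NormedAddCommGroup K] [InnerProductSpace ℂ K] [CompleteSpace K]
    {T : Fin n → Sum3 H₁ H₀ Hm →L[ℂ] Sum3 H₁ H₀ Hm} {N : Fin n → K →L[ℂ] K}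
    (h : HasPartialIsometryFactorization T N) :
    ∃ (E : Type u) (_ : NormedAddCommGroup E) (_ : InnerProductSpace ℂ E) (_ : CompleteSpace E)
      (G₁ : Space n (WithLp 2 (defectSpace (adjoint (row N)) × E)) →L[ℂ]
        Space n (defectSpace (adjoint (row T))))
      (G₂ : Space n (defectSpace (row T)) →L[ℂ] Space n (WithLp 2 (defectSpace (row N) × E))),
      IsCoisometry G₁ ∧ IsPartialIsometry G₂ ∧ charOp T = G₁ ∘L diagId (charOp N) E ∘L G₂ := by
  refine h.elim fun E h => h.elim fun i₁ h => h.elim fun i₂ h => h.elim fun i₃ h =>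
    h.elim fun G₁ h => h.elim fun G₂ h => ?_
  refine ⟨E, i₁, i₂, i₃, ?_⟩
  refine ⟨G₁, ?_⟩
  refine ⟨G₂, ?_⟩
  refine ⟨?_, ?_, ?_⟩
  · exact h.1
  · exact h.2.1
  · exact h.2.2

lemma isOrthogonalSum_withLp {A B : Type*} [NormedAddCommGroup A] [InnerProductSpace ℂ A]
    [NormedAddCommGroup B] [InnerProductSpace ℂ B] :
    IsOrthogonalSum (WithLp.linearEquiv 2 ℂ (A × B)) :=
  fun x y => WithLp.prod_inner_apply x y

lemma exists_isBlockTriangular {H₁ H₀ Hm : Type*}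
    [NormedAddCommGroup H₁] [InnerProductSpace ℂ H₁] [CompleteSpace H₁]
    [NormedAddCommGroup H₀] [InnerProductSpace ℂ H₀] [CompleteSpace H₀]
    [NormedAddCommGroup Hm] [InnerProductSpace ℂ Hm] [CompleteSpace Hm]
    {T : Fin n → Sum3 H₁ H₀ Hm →L[ℂ] Sum3 H₁ H₀ Hm}
    {S : Fin n → H₁ →L[ℂ] H₁} {N : Fin n → H₀ →L[ℂ] H₀} {C : Fin n → Hm →L[ℂ] Hm}
    (hmat : ∀ i, IsUpperTriangular (T i) (S i) (N i) (C i)) :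
    ∃ (V : Fin n → WithLp 2 (H₀ × Hm) →L[ℂ] H₁)
      (Q : Fin n → WithLp 2 (H₀ × Hm) →L[ℂ] WithLp 2 (H₀ × Hm)) (Z : Fin n → Hm →L[ℂ] H₀),
      IsBlockTriangular (WithLp.linearEquiv 2 ℂ (H₁ × WithLp 2 (H₀ × Hm))) T S V Q ∧
      IsBlockTriangular (WithLp.linearEquiv 2 ℂ (H₀ × Hm)) Q N Z C := by
  choose X Y Z h using hmat
  -- The compression of `Tᵢ` to the last two summands, `[[Nᵢ, Zᵢ], [0, Cᵢ]]`.
  let Q : Fin n → WithLp 2 (H₀ × Hm) →L[ℂ] WithLp 2 (H₀ × Hm) := fun i =>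
    (WithLp.prodContinuousLinearEquiv 2 ℂ H₀ Hm).symm ∘L
      (N i ∘L WithLp.fstL 2 ℂ H₀ Hm + Z i ∘L WithLp.sndL 2 ℂ H₀ Hm).prod
        (C i ∘L WithLp.sndL 2 ℂ H₀ Hm)
  refine ⟨fun i => X i ∘L WithLp.fstL 2 ℂ H₀ Hm + Y i ∘L WithLp.sndL 2 ℂ H₀ Hm, Q, Z,
    ⟨isOrthogonalSum_withLp, fun i y => ?_⟩, ⟨isOrthogonalSum_withLp, fun i y => rfl⟩⟩
  refine (congrArg (WithLp.linearEquiv 2 ℂ (H₁ × WithLp 2 (H₀ × Hm)))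
    (h i y.fst y.snd.fst y.snd.snd)).trans (Prod.ext ?_ rfl)
  exact add_assoc _ _ _

end MainTheorem

end DruryArveson

open ContinuousLinearMap DruryArveson

set_option maxHeartbeats 1000000 in
theorem mainTheorem5 {n : ℕ} {H₁ H₀ Hm : Type u}
    [NormedAddCommGroup H₁] [InnerProductSpace ℂ H₁] [CompleteSpace H₁]
    [NormedAddCommGroup H₀] [InnerProductSpace ℂ H₀] [CompleteSpace H₀]
    [NormedAddCommGroup Hm] [InnerProductSpace ℂ Hm] [CompleteSpace Hm]
    (T : Fin n → Sum3 H₁ H₀ Hm →L[ℂ] Sum3 H₁ H₀ Hm) (hT : IsCommutingRowContraction T)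
    (S : Fin n → H₁ →L[ℂ] H₁) (N : Fin n → H₀ →L[ℂ] H₀) (C : Fin n → Hm →L[ℂ] Hm)
    (hmat : ∀ i, IsUpperTriangular (T i) (S i) (N i) (C i)) :
    (IsCommutingRowContraction S ∧ IsCommutingRowContraction N ∧ IsCommutingRowContraction C) ∧
    (IsMultiplier (charFun T) ∧ IsMultiplier (charFun S) ∧ IsMultiplier (charFun N) ∧
      IsMultiplier (charFun C)) ∧
    (∃ (E₁ : Type u) (_ : NormedAddCommGroup E₁) (_ : InnerProductSpace ℂ E₁)
        (_ : CompleteSpace E₁)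
        (E₂ : Type u) (_ : NormedAddCommGroup E₂) (_ : InnerProductSpace ℂ E₂)
        (_ : CompleteSpace E₂)
        (E : Type u) (_ : NormedAddCommGroup E) (_ : InnerProductSpace ℂ E) (_ : CompleteSpace E)
        (U₁ : WithLp 2 (defectSpace (adjoint (row N)) × E) ≃ₗᵢ[ℂ]
          WithLp 2 (defectSpace (row C) × E₁))
        (U₂ : WithLp 2 (defectSpace (adjoint (row S)) × E₂) ≃ₗᵢ[ℂ]
          WithLp 2 (defectSpace (row N) × E)),
      Coincides (charOp T)
        (diagId (charOp C) E₁ ∘L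
          ampl n (U₁ : WithLp 2 (defectSpace (adjoint (row N)) × E) →L[ℂ]
            WithLp 2 (defectSpace (row C) × E₁)) ∘L
          diagId (charOp N) E ∘L
          ampl n (U₂ : WithLp 2 (defectSpace (adjoint (row S)) × E₂) →L[ℂ]
            WithLp 2 (defectSpace (row N) × E)) ∘L
          diagId (charOp S) E₂)) ∧
    (IsShift S → IsSphericalCoisometry C →
      ∃ (E : Type u) (_ : NormedAddCommGroup E) (_ : InnerProductSpace ℂ E) (_ : CompleteSpace E)
        (G₁ : Space n (WithLp 2 (defectSpace (adjoint (row N)) × E)) →L[ℂ]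
          Space n (defectSpace (adjoint (row T))))
        (G₂ : Space n (defectSpace (row T)) →L[ℂ]
          Space n (WithLp 2 (defectSpace (row N) × E))),
        IsCoisometry G₁ ∧ IsPartialIsometry G₂ ∧
          charOp T = G₁ ∘L diagId (charOp N) E ∘L G₂) := by
  refine (exists_isBlockTriangular hmat).elim fun V h => h.elim fun Q h => h.elim fun Z h => ?_
  have h' := h.2
  replace h := h.1
  have hQ := h.snd_isCommutingRowContraction hT
  have hS := h.fst_isCommutingRowContraction hT
  have hN := h'.fst_isCommutingRowContraction hQ
  have hC := h'.snd_isCommutingRowContraction hQ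
  refine ⟨⟨hS, hN, hC⟩, ⟨isMultiplier_charFun hT.contraction, isMultiplier_charFun hS.contraction,
    isMultiplier_charFun hN.contraction, isMultiplier_charFun hC.contraction⟩,
    h.exists_coincides h' hT.contraction, fun hshift hco => ?_⟩
  have hS0 := hshift.charOp_eq_zero hS.contraction
  have : Subsingleton (defectSpace (adjoint (row C))) := hco.subsingleton_defectSpace
  exact (h.hasPartialIsometryFactorization h' hT.contraction hS0).exists_of_sum3
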